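/- Let $d\ge 1$ be an integer and let $\alpha,\lambda,\mu>0$. Let $N=\{N(t)\}_{t\ge 0}$ be the time-homogeneous continuous-time Markov process on the set $S=\{0\}\cup\{k_j : k\ge 1,\ 1\le j\le d\}$ ($d$ semiaxes with common origin $0=0_j$), with $N(0)=0$ almost surely and with transition rates $$q(0,1_j)=\alpha,\qquad q(k_j,(k+1)_j)=\alpha+\lambda k,\qquad q(k_j,(k-1)_j)=\mu k \qquad (k\ge 1,\ 1\le j\le d),$$ and no other transitions; here $q(u,v)=\lim_{h\to0^+}\frac1h\,\mathbb P[N(t+h)=v\mid N(t)=u]$ for $u\neq v$, and $\lim_{h\to0^+}\frac1h\,(1-\mathbb P[N(t+h)=u\mid N(t)=u])=\sum_{v\ne u}q(u,v)$. Put $p(0,t)=\mathbb P\{N(t)=0\}$. Let $A_n$ be the Eulerian polynomials, $A_0=1$, $A_{n+1}(x)=(1+nx)A_n(x)+x(1-x)A_n'(x)$ (so $A_1=1$, $A_2=1+x$, $A_3=1+4x+x^2$), and put $$Q_{j,m}=\sum_{\substack{s_1,\dots,s_j\ge 2\\ s_1+\cdots+s_j=m}}A_{s_1}\!\left(\tfrac{\mu}{\lambda}\right)\cdots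 A_{s_j}\!\left(\tfrac{\mu}{\lambda}\right).$$ Suppose that $\alpha=\lambda$ and $\mu\ne\lambda$. Then for $0<t<\dfrac{\log(\mu/\lambda)}{\mu-\lambda}$ we have $$p(0,t)=1-d\left\{1-\frac{\mu-\lambda}{\mu-\lambda e^{-(\mu-\lambda)t}}-\frac{1}{d-1}\left[e^{-\lambda t(d-1)}-1+\lambda t(d-1)\right]-\sum_{n=3}^{\infty}\frac{(-\lambda t)^n}{n!}\sum_{k=1}^{n-2}(d-1)^k\sum_{j=1}^{n-k-1}\binom{k+1}{j}Q_{j,\,j+n-k-1}\right\},$$ where the series over $n$ converges absolutely and, for $d=1$, the term with the factor $\frac1{d-1}$ is read as $0$ (its limit as $d\to1$). Moreover, on this interval both the function $p(0,\cdot)$ and the function defined by the right-hand side (with value $1$ at $t=0$) satisfy the integral equation $$p(0,t)=1-G(t)-(d-1)\int_0^tG'(t-y)\,p(0,y)\,dy,\qquad G(t)=1-\frac{\mu-\lambda}{\mu-\lambda e^{-(\mu-\lambda)t}}.$$ -/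

import Mathlib

open scoped NNReal Topology

/-! ### The random walk on the spider -/

/-- The state space: `d` semiaxes with a common origin.
`ray j k` is the state at distance `k + 1` from the origin on the `j`-th semiaxis. -/
inductive Spider (d : ℕ) : Type
  | origin : Spider d
  | ray (j : Fin d) (k : ℕ) : Spider d

instance (d : ℕ) : MeasurableSpace (Spider d) := ⊤

/-- The matrix of transition rates. Off the diagonal: `0 → 1_j` at rate `α`,
`k_j → (k+1)_j` at rate `α + lam * k`, `k_j → (k-1)_j` at rate `mu * k` (with `0_j = 0`),
and no other transitions. On the diagonal: minus the total rate of leaving the state. -/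
noncomputable def Spider.rate (d : ℕ) (α lam mu : ℝ) : Spider d → Spider d → ℝ
  | .origin, .origin => -(d * α)
  | .origin, .ray _ l => if l = 0 then α else 0
  | .ray _ k, .origin => if k = 0 then mu else 0
  | .ray j k, .ray i l =>
      if i = j then
        if l = k + 1 then α + lam * (k + 1)
        else if l + 1 = k then mu * (k + 1)
        else if l = k then -(α + (lam + mu) * (k + 1))
        else 0
      else 0

/-- `T t u v` is the transition function of a time-homogeneous Markov chain in continuous time on
`S`: stochastic matrices that form a semigroup. -/
structure IsTransitionFunction {S : Type*} (T : ℝ≥0 → S → S → ℝ) : Prop where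
  nonneg : ∀ t u v, 0 ≤ T t u v
  hasSum_one : ∀ t u, HasSum (fun v => T t u v) 1
  zero_self : ∀ u, T 0 u u = 1
  zero_ne : ∀ u v, u ≠ v → T 0 u v = 0
  chapman_kolmogorov : ∀ s t u v, HasSum (fun w => T s u w * T t w v) (T (s + t) u v)

/-- The transition function `T` has transition rates `q`: the right derivative of `T` at time `0`
is `q`. For `u ≠ v` this says `q u v = lim_{h → 0+} T h u v / h`, and for `u = v` it says
`- q u u = lim_{h → 0+} (1 - T h u u) / h`. -/
def HasTransitionRates {S : Type*} (T : ℝ≥0 → S → S → ℝ) (q : S → S → ℝ) : Prop :=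
  ∀ u v, Filter.Tendsto (fun h : ℝ≥0 => (T h u v - T 0 u v) / (h : ℝ)) (𝓝[>] 0) (𝓝 (q u v))

/-- The process `N` on the probability space `(Ω, P)` is a Markov process with transition
function `T`: for every event `A` of the history of `N` up to time `s`,
`P(A, N(s) = u, N(s + h) = v) = P(A, N(s) = u) T_h(u, v)`. -/
def HasMarkovTransition {S : Type*} [MeasurableSpace S] {Ω : Type*} [MeasurableSpace Ω]
    (P : MeasureTheory.Measure Ω) (N : ℝ≥0 → Ω → S) (T : ℝ≥0 → S → S → ℝ) : Prop :=
  ∀ (s h : ℝ≥0) (u v : S) (A : Set Ω),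
    @MeasurableSet Ω (⨆ r ∈ Set.Iic s, MeasurableSpace.comap (N r) inferInstance) A →
      P.real (A ∩ {ω | N s ω = u} ∩ {ω | N (s + h) ω = v}) =
        P.real (A ∩ {ω | N s ω = u}) * T h u v

/-- `N` is the Markov process on the spider with the rates above, started at the origin. -/
structure IsSpiderProcess (d : ℕ) (α lam mu : ℝ) {Ω : Type*} [MeasurableSpace Ω]
    (P : MeasureTheory.Measure Ω) (N : ℝ≥0 → Ω → Spider d) : Prop where
  measurable : ∀ t, Measurable (N t)
  initial : ∀ᵐ ω ∂P, N 0 ω = Spider.origin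
  markov : ∃ T : ℝ≥0 → Spider d → Spider d → ℝ,
    IsTransitionFunction T ∧ HasTransitionRates T (Spider.rate d α lam mu) ∧
      HasMarkovTransition P N T

/-- The probability `p(0,t)` that the process is at the origin at time `t ≥ 0`. -/
noncomputable def originProb {d : ℕ} {Ω : Type*} [MeasurableSpace Ω]
    (P : MeasureTheory.Measure Ω) (N : ℝ≥0 → Ω → Spider d) (t : ℝ) : ℝ :=
  P.real {ω | N t.toNNReal ω = Spider.origin}

/-! ### The integral equation -/

/-- The function `h(t, z; lam, mu)`; for `lam ≠ mu` the base of the power is written as one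
(positive) quotient, which also makes sense when `lam < mu`. -/
noncomputable def spiderH (α lam mu z t : ℝ) : ℝ :=
  if lam = mu then (1 / (1 + lam * t * (1 - z))) ^ (α / lam)
  else
    ((lam - mu) * Real.exp (-((lam - mu) * t)) /
      (lam * (1 - z) - (mu - lam * z) * Real.exp (-((lam - mu) * t)))) ^ (α / lam)

/-- `G(t) = 1 - h(t, 0; lam, mu)`. -/
noncomputable def spiderG (α lam mu t : ℝ) : ℝ := 1 - spiderH α lam mu 0 t

/-- `f` satisfies, at time `t`, the Volterra integral equation
`f(t) = 1 - G(t) - (d - 1) ∫_0^t G'(t - y) f(y) dy` (with an integral that exists). -/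
def SatisfiesVolterra (d : ℕ) (α lam mu : ℝ) (f : ℝ → ℝ) (t : ℝ) : Prop :=
  IntervalIntegrable (fun y => deriv (spiderG α lam mu) (t - y) * f y) MeasureTheory.volume 0 t ∧
    f t = 1 - spiderG α lam mu t -
      ((d : ℝ) - 1) * ∫ y in (0 : ℝ)..t, deriv (spiderG α lam mu) (t - y) * f y

/-! ### Eulerian polynomials and the power series -/

/-- The Eulerian polynomials, by Euler's recurrence
`A_0 = 1`, `A_{n+1}(x) = (1 + n x) A_n(x) + x (1 - x) A_n'(x)`:
`A_1 = 1`, `A_2 = 1 + x`, `A_3 = 1 + 4 x + x^2`. -/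
noncomputable def eulerianPoly : ℕ → Polynomial ℝ
  | 0 => 1
  | n + 1 =>
      (1 + (n : Polynomial ℝ) * Polynomial.X) * eulerianPoly n +
        Polynomial.X * (1 - Polynomial.X) * Polynomial.derivative (eulerianPoly n)

/-- `Q_{j,m}(x)`: the sum of `A_{s_1}(x) ⋯ A_{s_j}(x)` over all `s_1, …, s_j ≥ 2` with
`s_1 + ⋯ + s_j = m`. -/
noncomputable def eulerianQ (j m : ℕ) (x : ℝ) : ℝ :=
  ∑ s ∈ (Finset.Nat.antidiagonalTuple j m).filter (fun s => ∀ i, 2 ≤ s i),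
    ∏ i, (eulerianPoly (s i)).eval x

/-- The `n`-th term (`n ≥ 3`) of the series in the formula for `p(0,t)`. -/
noncomputable def originTerm (d : ℕ) (lam mu t : ℝ) (n : ℕ) : ℝ :=
  (-(lam * t)) ^ n / (n.factorial : ℝ) *
    ∑ k ∈ Finset.Icc 1 (n - 2), ((d : ℝ) - 1) ^ k *
      ∑ j ∈ Finset.Icc 1 (n - k - 1), ((k + 1).choose j : ℝ) *
        eulerianQ j (j + (n - k - 1)) (mu / lam)

/-- The right-hand side of the formula for `p(0,t)`. For `d = 1` the term with the factor
`1 / (d - 1)` is `0`, which is its limit as `d → 1`. -/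
noncomputable def originFormula (d : ℕ) (lam mu t : ℝ) : ℝ :=
  1 - d * (1 - (mu - lam) / (mu - lam * Real.exp (-((mu - lam) * t)))
    - 1 / ((d : ℝ) - 1) *
        (Real.exp (-(lam * t * ((d : ℝ) - 1))) - 1 + lam * t * ((d : ℝ) - 1))
    - ∑' n : ℕ, originTerm d lam mu t (n + 3))

/-! The proof has two halves, the Volterra equation for the process and the same equation for the
series, joined by uniqueness of continuous solutions.

Process. Every row of the rate matrix is finite and sums to zero, so the backward equations hold for
any transition function with these rates, with no non-explosion argument. Let `a k r` be the
probability of being at the origin at time `r`, averaged over the starting points at distance `k`,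
and let `h` be `halfLineProb`. For `d = 1` the walk from the origin has geometric law `h (1 - h) ^
k`. Pairing this law at time `t - r` with `a k r` gives a quantity that equals `h t` at `r = 0` and
`a 0 t` at `r = t`. Its derivative differs from zero only by a defect at the origin, proportional to
`d - 1`. A second identity, for `h (t - r) * a 0 r`, eliminates the unknown `a 1`
(`volterra_of_backward`, `transition_volterra`).

Series. `h` is the exponential generating function of `(-lam) ^ n * A_n(mu / lam)`
(`hasSum_halfLineProb`). A convolution of exponential generating functions is a Cauchy product of
coefficients with a shift (`hasSum_convolution`), so the equation becomes a renewal recursion. It is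
solved by the coefficients of `∑ c ^ k B ^ (k + 1)`, with `c = d - 1` and `B = ∑_{n ≥ 1} A_n X ^ n`
(`renewalCoeff_succ`). Expanding `B = X + tail` binomially produces the sums `Q_{j,m}`; the term `k
= 0` resums to `h`, and the pure powers of `X` with `k ≥ 1` to the exponential
(`renewalCoeff_add_two`, `originTerm_eq`).

Uniqueness is Grönwall's inequality (`eq_zero_of_volterra`). -/

/-! ### Transition functions: continuity and backward equations. -/

theorem IsTransitionFunction.le_one {S : Type*} {T : ℝ≥0 → S → S → ℝ}
    (hT : IsTransitionFunction T) (t : ℝ≥0) (u v : S) : T t u v ≤ 1 :=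
  le_hasSum (hT.hasSum_one t u) v fun w _ => hT.nonneg t u w

/-- The terms of the Chapman–Kolmogorov sum outside a finite set of intermediate states. -/
theorem IsTransitionFunction.chapman_kolmogorov_remainder {S : Type*} {T : ℝ≥0 → S → S → ℝ}
    (hT : IsTransitionFunction T) (F : Finset S) (s t : ℝ≥0) (u v : S) :
    0 ≤ T (s + t) u v - ∑ w ∈ F, T s u w * T t w v ∧
      T (s + t) u v - ∑ w ∈ F, T s u w * T t w v ≤ 1 - ∑ w ∈ F, T s u w := by
  have h1 := hT.chapman_kolmogorov s t u v
  have h2 := hT.hasSum_one s u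
  have hn : ∀ w, 0 ≤ T s u w * T t w v := fun w => mul_nonneg (hT.nonneg _ _ _) (hT.nonneg _ _ _)
  refine ⟨sub_nonneg.2 (sum_le_hasSum F (fun w _ => hn w) h1), ?_⟩
  -- The upper bound is the same partial-sum inequality for the nonnegative defects `T s u w * (1 -
  -- T t w v)`.
  have h3 := h2.sub h1
  have h4 := sum_le_hasSum F (fun w _ => ?_) h3
  · rw [Finset.sum_sub_distrib] at h4
    linarith
  · have := mul_le_mul_of_nonneg_left (hT.le_one t w v) (hT.nonneg s u w)
    linarith

/-- The difference is the remainder for `F = {u}` minus `(1 - T s u u) * T t u v`, and both lie in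
`[0, 1 - T s u u]`. -/
theorem IsTransitionFunction.abs_sub_le {S : Type*} {T : ℝ≥0 → S → S → ℝ}
    (hT : IsTransitionFunction T) (s t : ℝ≥0) (u v : S) :
    |T (s + t) u v - T t u v| ≤ 1 - T s u u := by
  obtain ⟨h1, h2⟩ := hT.chapman_kolmogorov_remainder {u} s t u v
  simp only [Finset.sum_singleton] at h1 h2
  have h3 := hT.le_one s u u
  have h4 := hT.le_one t u v
  have h5 := hT.nonneg t u v
  rw [abs_le]
  constructor <;> nlinarith

open Filter in
/-- Kolmogorov's backward equation for a state whose row of rates is finite and conservative. -/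
theorem IsTransitionFunction.tendsto_backward {S : Type*} {T : ℝ≥0 → S → S → ℝ}
    (hT : IsTransitionFunction T) {q : S → S → ℝ} (hq : HasTransitionRates T q)
    (F : Finset S) {u : S} (hu : u ∈ F) (hF : ∑ w ∈ F, q u w = 0) (v : S) (t : ℝ≥0) :
    Tendsto (fun h : ℝ≥0 => (T (h + t) u v - T t u v) / (h : ℝ)) (𝓝[>] 0)
      (𝓝 (∑ w ∈ F, q u w * T t w v)) := by
  have hz : ∀ g : S → ℝ, ∑ w ∈ F, T 0 u w * g w = g u := by
    intro g
    rw [Finset.sum_eq_single_of_mem u hu, hT.zero_self, one_mul]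
    intro w _ hw
    rw [hT.zero_ne u w hw.symm, zero_mul]
  have h1 : Tendsto (fun h : ℝ≥0 => ∑ w ∈ F, (T h u w - T 0 u w) / (h : ℝ) * T t w v) (𝓝[>] 0)
      (𝓝 (∑ w ∈ F, q u w * T t w v)) :=
    tendsto_finsetSum _ fun w _ => (hq u w).mul_const _
  have h2 : Tendsto (fun h : ℝ≥0 => ∑ w ∈ F, (T h u w - T 0 u w) / (h : ℝ)) (𝓝[>] 0) (𝓝 0) := by
    rw [← hF]
    exact tendsto_finsetSum _ fun w _ => hq u w
  have e1 : ∀ h : ℝ≥0, ∑ w ∈ F, (T h u w - T 0 u w) / (h : ℝ) * T t w v =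
      (∑ w ∈ F, T h u w * T t w v - T t u v) / (h : ℝ) := by
    intro h
    rw [← hz (fun w => T t w v), ← Finset.sum_sub_distrib, Finset.sum_div]
    exact Finset.sum_congr rfl fun w _ => by ring
  have e2 : ∀ h : ℝ≥0, ∑ w ∈ F, (T h u w - T 0 u w) / (h : ℝ) =
      (∑ w ∈ F, T h u w - 1) / (h : ℝ) := by
    intro h
    have := hz (fun _ => 1)
    simp only [mul_one] at this
    rw [← Finset.sum_div, Finset.sum_sub_distrib, this]
  have h3 := h1.sub h2
  rw [sub_zero] at h3
  -- The mass that leaves `F` in time `h` is `o(h)` because the rates in `F` already sum to zero;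
  -- this squeezes the quotient.
  refine tendsto_of_tendsto_of_tendsto_of_le_of_le h1 h3 (fun h => ?_) fun h => ?_
  · obtain ⟨hr, -⟩ := hT.chapman_kolmogorov_remainder F h t u v
    simp only [e1]
    exact div_le_div_of_nonneg_right (by linarith) h.2
  · obtain ⟨-, hr⟩ := hT.chapman_kolmogorov_remainder F h t u v
    simp only [e1, e2, ← sub_div]
    exact div_le_div_of_nonneg_right (by linarith) h.2

open Filter in
theorem IsTransitionFunction.hasDerivWithinAt_backward {S : Type*} {T : ℝ≥0 → S → S → ℝ}
    (hT : IsTransitionFunction T) {q : S → S → ℝ} (hq : HasTransitionRates T q)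
    (F : Finset S) {u : S} (hu : u ∈ F) (hF : ∑ w ∈ F, q u w = 0) (v : S) {t : ℝ} (ht : 0 ≤ t) :
    HasDerivWithinAt (fun r : ℝ => T r.toNNReal u v) (∑ w ∈ F, q u w * T t.toNNReal w v)
      (Set.Ioi t) t := by
  rw [hasDerivWithinAt_iff_tendsto_slope' (by simp)]
  have h1 : Tendsto (fun y : ℝ => (y - t).toNNReal) (𝓝[>] t) (𝓝[>] 0) := by
    refine tendsto_nhdsWithin_iff.2 ⟨?_, ?_⟩
    · have : Continuous fun y : ℝ => (y - t).toNNReal := by fun_prop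
      have h := this.tendsto t
      simp only [sub_self, Real.toNNReal_zero] at h
      exact h.mono_left nhdsWithin_le_nhds
    · filter_upwards [self_mem_nhdsWithin] with y hy
      simpa using hy
  refine ((hT.tendsto_backward hq F hu hF v t.toNNReal).comp h1).congr' ?_
  filter_upwards [self_mem_nhdsWithin] with y hy
  have hy' : 0 ≤ y - t := sub_nonneg.2 (le_of_lt hy)
  simp only [Function.comp_apply, slope_def_field]
  rw [← Real.toNNReal_add hy' ht, sub_add_cancel, Real.coe_toNNReal _ hy']

open Filter in
theorem IsTransitionFunction.tendsto_self {S : Type*} {T : ℝ≥0 → S → S → ℝ}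
    (hT : IsTransitionFunction T) {q : S → S → ℝ} (hq : HasTransitionRates T q) (u : S) :
    Tendsto (fun h => T h u u) (𝓝 0) (𝓝 1) := by
  have h1 : Tendsto (fun h : ℝ≥0 => (h : ℝ)) (𝓝[>] 0) (𝓝 0) :=
    (NNReal.continuous_coe.tendsto 0).mono_left nhdsWithin_le_nhds
  have h2 := ((hq u u).mul h1).add_const 1
  rw [mul_zero, zero_add] at h2
  have h3 : Tendsto (fun h => T h u u) (𝓝[>] 0) (𝓝 1) := by
    refine h2.congr' ?_
    filter_upwards [self_mem_nhdsWithin] with h hh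
    have : (h : ℝ) ≠ 0 := by
      have : (0 : ℝ≥0) < h := hh
      exact_mod_cast this.ne'
    rw [hT.zero_self, div_mul_cancel₀ _ this]
    ring
  have h4 : (𝓝 (0 : ℝ≥0)) = pure 0 ⊔ 𝓝[>] 0 := by
    rw [← nhdsWithin_singleton, ← nhdsWithin_union]
    have : ({0} ∪ Set.Ioi 0 : Set ℝ≥0) = Set.univ :=
      Set.eq_univ_of_forall fun y => (eq_or_ne y 0).imp id pos_iff_ne_zero.2
    rw [this, nhdsWithin_univ]
  rw [h4, tendsto_sup]
  refine ⟨?_, h3⟩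
  rw [tendsto_pure_left]
  intro s hs
  rw [hT.zero_self]
  exact mem_of_mem_nhds hs

-- Continuity in `t` follows from `abs_sub_le` with the smaller of the two times as base point and
-- their distance as increment.
open Filter in
theorem IsTransitionFunction.continuous {S : Type*} {T : ℝ≥0 → S → S → ℝ}
    (hT : IsTransitionFunction T) {q : S → S → ℝ} (hq : HasTransitionRates T q) (u v : S) :
    Continuous fun t => T t u v := by
  rw [continuous_iff_continuousAt]
  intro t
  rw [ContinuousAt, tendsto_iff_norm_sub_tendsto_zero]
  have h1 : Tendsto (fun s : ℝ≥0 => 1 - T (max s t - min s t) u u) (𝓝 t) (𝓝 0) := by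
    have hc : Continuous fun s : ℝ≥0 => max s t - min s t := by fun_prop
    have h := hc.tendsto t
    simp only [max_self, min_self, tsub_self] at h
    simpa using ((hT.tendsto_self hq u).comp h).const_sub 1
  refine squeeze_zero (fun _ => norm_nonneg _) (fun s => ?_) h1
  rw [Real.norm_eq_abs]
  rcases le_total s t with h | h
  · have := hT.abs_sub_le (t - s) s u v
    rw [tsub_add_cancel_of_le h] at this
    rw [max_eq_right h, min_eq_left h, abs_sub_comm]
    exact this
  · have := hT.abs_sub_le (s - t) t u v
    rw [tsub_add_cancel_of_le h] at this
    rw [max_eq_left h, min_eq_right h]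
    exact this

/-! ### Duality with the walk on one semiaxis. -/

open intervalIntegral in
/-- Duality between the backward equations of the walk on `d` semiaxes and the geometric law
`h (1 - h) ^ k` of the walk on one semiaxis. -/
theorem volterra_of_backward {lam mu d : ℝ} {h : ℝ → ℝ}
    (hh : ∀ s, 0 ≤ s → HasDerivAt h (h s * (mu - lam - mu * h s)) s) (h0 : h 0 = 1)
    (hpos : ∀ s, 0 ≤ s → 0 < h s) (hle : ∀ s, 0 ≤ s → h s ≤ 1) {a : ℕ → ℝ → ℝ}
    (ha : ∀ k r, |a k r| ≤ 1) (hc : ∀ k, Continuous (a k)) (ha0 : a 0 0 = 1)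
    (hak : ∀ k, a (k + 1) 0 = 0)
    (hd0 : ∀ r, 0 ≤ r → HasDerivWithinAt (a 0) (d * lam * (a 1 r - a 0 r)) (Set.Ioi r) r)
    (hdk : ∀ k r, 0 ≤ r → HasDerivWithinAt (a (k + 1))
      (lam * (k + 2) * (a (k + 2) r - a (k + 1) r) + mu * (k + 1) * (a k r - a (k + 1) r))
      (Set.Ioi r) r) {t : ℝ} (ht : 0 ≤ t) :
    a 0 t = h t + (d - 1) * ∫ y in (0 : ℝ)..t, h (t - y) * (mu - lam - mu * h (t - y)) * a 0 y := by
  have hcont : ContinuousOn (fun r => h (t - r)) (Set.Icc 0 t) := by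
    intro r hr
    have h1 : ContinuousAt h (t - r) := (hh _ (sub_nonneg.2 hr.2)).continuousAt
    exact (ContinuousAt.comp (f := fun r => t - r) h1 (by fun_prop)).continuousWithinAt
  have hder : ∀ r, r ≤ t → HasDerivAt (fun r => h (t - r))
      (-(h (t - r) * (mu - lam - mu * h (t - r)))) r := by
    intro r hr
    exact (hh _ (sub_nonneg.2 hr)).comp_const_sub t r
  set M : ℕ → ℝ → ℝ := fun K r => ∑ k ∈ Finset.range (K + 1), h (t - r) * (1 - h (t - r)) ^ k * a k r
    with hM
  set I : ℝ → ℝ := fun r => lam * h (t - r) * (a 1 r - a 0 r) with hI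
  -- The flux across the edge between `K` and `K + 1`: all that is left of the telescoping interior
  -- terms after truncation at `K`.
  set bd : ℕ → ℝ → ℝ := fun K r => lam * (K + 1) * (h (t - r) * (1 - h (t - r)) ^ K) * a (K + 1) r -
    mu * (K + 1) * (h (t - r) * (1 - h (t - r)) ^ (K + 1)) * a K r with hbd
  have hMd : ∀ K r, 0 ≤ r → r ≤ t →
      HasDerivWithinAt (M K) ((d - 1) * I r + bd K r) (Set.Ioi r) r := by
    intro K r hr hrt
    induction K with
    | zero =>
      have h1 := (hder r hrt).hasDerivWithinAt (s := Set.Ioi r) |>.mul (hd0 r hr)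
      simp only [hM, zero_add, Finset.range_one, Finset.sum_singleton, pow_zero, mul_one]
      refine h1.congr_deriv ?_
      simp only [hI, hbd]
      push_cast
      ring
    | succ K ih =>
      have h1 := (hder r hrt).hasDerivWithinAt (s := Set.Ioi r)
      have h2 := (h1.mul ((h1.const_sub 1).pow (K + 1))).mul (hdk K r hr)
      have h3 := ih.add h2
      have e : M (K + 1) = fun r => M K r + h (t - r) * (1 - h (t - r)) ^ (K + 1) * a (K + 1) r := by
        funext r
        simp only [hM]
        rw [Finset.sum_range_succ]
      rw [e]
      refine h3.congr_deriv ?_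
      simp only [hI, hbd, Pi.mul_apply, Pi.pow_apply, Nat.add_sub_cancel]
      push_cast
      ring
  have hMc : ∀ K, ContinuousOn (M K) (Set.Icc 0 t) := by
    intro K
    refine continuousOn_finsetSum _ fun k _ => ?_
    exact (hcont.mul ((continuousOn_const.sub hcont).pow k)).mul (hc k).continuousOn
  have hIc : ContinuousOn I (Set.Icc 0 t) :=
    (continuousOn_const.mul hcont).mul ((hc 1).sub (hc 0)).continuousOn
  have hbdc : ∀ K, ContinuousOn (bd K) (Set.Icc 0 t) := by
    intro K
    exact ((continuousOn_const.mul (hcont.mul ((continuousOn_const.sub hcont).pow K))).mul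
      (hc _).continuousOn).sub ((continuousOn_const.mul (hcont.mul
        ((continuousOn_const.sub hcont).pow (K + 1)))).mul (hc _).continuousOn)
  have hIi : IntervalIntegrable I MeasureTheory.volume 0 t :=
    hIc.intervalIntegrable_of_Icc ht
  have hbi : ∀ K, IntervalIntegrable (bd K) MeasureTheory.volume 0 t :=
    fun K => (hbdc K).intervalIntegrable_of_Icc ht
  have key : ∀ K, a 0 t - h t = (d - 1) * (∫ r in (0 : ℝ)..t, I r) + ∫ r in (0 : ℝ)..t, bd K r := by
    intro K
    rw [← integral_const_mul, ← integral_add (hIi.const_mul _) (hbi K)]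
    rw [integral_eq_sub_of_hasDeriv_right_of_le ht (hMc K)
      (fun r hr => hMd K r hr.1.le hr.2.le) ((hIi.const_mul _).add (hbi K))]
    congr 1
    · simp only [hM, sub_self, h0]
      rw [Finset.sum_range_succ']
      simp
    · simp only [hM, sub_zero]
      rw [Finset.sum_range_succ']
      simp [hak, ha0]
  -- A positive minimum of `h` makes the geometric tails uniformly small, so that the flux is `O((K
  -- + 1) * (1 - m) ^ K)`.
  obtain ⟨m, hm0, hm⟩ : ∃ m, 0 < m ∧ ∀ r ∈ Set.Icc 0 t, m ≤ h (t - r) := by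
    obtain ⟨x, hx, hmin⟩ := isCompact_Icc.exists_isMinOn (Set.nonempty_Icc.2 ht) hcont
    exact ⟨h (t - x), hpos _ (sub_nonneg.2 hx.2), fun r hr => hmin hr⟩
  have hm1 : m ≤ 1 := (hm 0 ⟨le_rfl, ht⟩).trans (hle _ (by simpa using ht))
  have hbb : ∀ K, ‖∫ r in (0 : ℝ)..t, bd K r‖ ≤ ((K + 1) * (1 - m) ^ K) * (|lam| + |mu|) * |t - 0| := by
    intro K
    refine norm_integral_le_of_norm_le_const fun r hr => ?_
    rw [Set.uIoc_of_le ht] at hr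
    have hr' : r ∈ Set.Icc 0 t := ⟨hr.1.le, hr.2⟩
    have p1 := hm r hr'
    have p2 := hle (t - r) (sub_nonneg.2 hr.2)
    set p := h (t - r)
    have q0 : 0 ≤ 1 - p := by linarith
    have q1 : (1 - p) ^ K ≤ (1 - m) ^ K := pow_le_pow_left₀ q0 (by linarith) K
    have q2 : (0 : ℝ) ≤ (1 - p) ^ K := pow_nonneg q0 K
    have q3 : p * (1 - p) ^ K ≤ (1 - m) ^ K := by nlinarith
    have q4 : p * (1 - p) ^ (K + 1) ≤ (1 - m) ^ K := by
      rw [pow_succ]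
      nlinarith [mul_nonneg (by linarith : 0 ≤ p) q2]
    have hK : (0 : ℝ) ≤ K + 1 := by positivity
    have q5 : 0 ≤ p * (1 - p) ^ K := mul_nonneg (by linarith) q2
    have q6 : 0 ≤ p * (1 - p) ^ (K + 1) := mul_nonneg (by linarith) (pow_nonneg q0 _)
    have b1 : ‖lam * (K + 1) * (p * (1 - p) ^ K) * a (K + 1) r‖ ≤
        |lam| * (K + 1) * (1 - m) ^ K := by
      rw [Real.norm_eq_abs, abs_mul, abs_mul, abs_mul, abs_of_nonneg hK, abs_of_nonneg q5]
      calc _ ≤ |lam| * (K + 1) * (1 - m) ^ K * 1 := by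
            gcongr
            exact ha _ _
        _ = _ := mul_one _
    have b2 : ‖mu * (K + 1) * (p * (1 - p) ^ (K + 1)) * a K r‖ ≤
        |mu| * (K + 1) * (1 - m) ^ K := by
      rw [Real.norm_eq_abs, abs_mul, abs_mul, abs_mul, abs_of_nonneg hK, abs_of_nonneg q6]
      calc _ ≤ |mu| * (K + 1) * (1 - m) ^ K * 1 := by
            gcongr
            exact ha _ _
        _ = _ := mul_one _
    calc ‖bd K r‖ ≤ _ := norm_sub_le _ _
      _ ≤ |lam| * (K + 1) * (1 - m) ^ K + |mu| * (K + 1) * (1 - m) ^ K := add_le_add b1 b2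
      _ = _ := by ring
  have hlim : Filter.Tendsto (fun K : ℕ => ∫ r in (0 : ℝ)..t, bd K r) Filter.atTop (𝓝 0) := by
    refine squeeze_zero_norm hbb ?_
    have e1 := tendsto_self_mul_const_pow_of_lt_one (r := 1 - m) (by linarith) (by linarith)
    have e2 := tendsto_pow_atTop_nhds_zero_of_lt_one (r := 1 - m) (by linarith) (by linarith)
    have e3 := ((e1.add e2).mul_const (|lam| + |mu|)).mul_const |t - 0|
    simp only [add_zero, zero_mul] at e3
    refine e3.congr fun K => ?_
    ring
  have hA : a 0 t - h t = (d - 1) * ∫ r in (0 : ℝ)..t, I r := by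
    have := (hlim.const_add ((d - 1) * ∫ r in (0 : ℝ)..t, I r))
    rw [add_zero] at this
    refine tendsto_nhds_unique ?_ this
    exact tendsto_const_nhds.congr key
  set J : ℝ → ℝ := fun y => h (t - y) * (mu - lam - mu * h (t - y)) * a 0 y with hJ
  have hJc : ContinuousOn J (Set.Icc 0 t) :=
    (hcont.mul (continuousOn_const.sub (continuousOn_const.mul hcont))).mul (hc 0).continuousOn
  have hJi : IntervalIntegrable J MeasureTheory.volume 0 t := hJc.intervalIntegrable_of_Icc ht
  -- A second expression for `a 0 t - h t`, from the term `k = 0` alone. Together with `hA` it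
  -- removes `I`, which contains the unknown `a 1`.
  have hB : a 0 t - h t = d * (∫ r in (0 : ℝ)..t, I r) - ∫ r in (0 : ℝ)..t, J r := by
    rw [← integral_const_mul, ← integral_sub (hIi.const_mul _) hJi,
      integral_eq_sub_of_hasDeriv_right_of_le ht (f := fun r => h (t - r) * a 0 r)
        (hcont.mul (hc 0).continuousOn) (fun r hr => ?_) ((hIi.const_mul _).sub hJi)]
    · simp [h0, ha0]
    · have h1 := (hder r hr.2.le).hasDerivWithinAt (s := Set.Ioi r) |>.mul (hd0 r hr.1.le)
      refine h1.congr_deriv ?_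
      simp only [hI, hJ]
      ring
  linear_combination hA + (d - 1) * (hA - hB)

/-! ### The return probability of the walk on one semiaxis. -/

/-- The probability that the walk on one semiaxis, started at the origin, is at the origin at
time `t`, in the case `α = lam ≠ mu`. -/
noncomputable def halfLineProb (lam mu t : ℝ) : ℝ :=
  (mu - lam) / (mu - lam * Real.exp (-((mu - lam) * t)))

theorem halfLineProb_zero {lam mu : ℝ} (hne : mu ≠ lam) : halfLineProb lam mu 0 = 1 := by
  simp [halfLineProb, div_self (sub_ne_zero.2 hne)]

/-- This quotient is the inverse of `halfLineProb`; in this form the signs `mu < lam` and `mu > lam`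
give one bound, which yields `0 < h ≤ 1`. -/
theorem one_le_halfLineProb_den_div {lam mu : ℝ} (hlam : 0 < lam) (hne : mu ≠ lam) {t : ℝ}
    (ht : 0 ≤ t) : 1 ≤ (mu - lam * Real.exp (-((mu - lam) * t))) / (mu - lam) := by
  rcases lt_or_gt_of_ne hne with h | h
  · rw [one_le_div_of_neg (by linarith)]
    have : 1 ≤ Real.exp (-((mu - lam) * t)) := Real.one_le_exp (by nlinarith)
    nlinarith
  · rw [one_le_div (by linarith)]
    have : Real.exp (-((mu - lam) * t)) ≤ 1 := Real.exp_le_one_iff.2 (by nlinarith)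
    nlinarith

theorem halfLineProb_pos {lam mu : ℝ} (hlam : 0 < lam) (hne : mu ≠ lam) {t : ℝ} (ht : 0 ≤ t) :
    0 < halfLineProb lam mu t := by
  have := one_le_halfLineProb_den_div hlam hne ht
  rw [halfLineProb, ← inv_div]
  positivity

theorem halfLineProb_le_one {lam mu : ℝ} (hlam : 0 < lam) (hne : mu ≠ lam) {t : ℝ} (ht : 0 ≤ t) :
    halfLineProb lam mu t ≤ 1 := by
  rw [halfLineProb, ← inv_div]
  exact inv_le_one_of_one_le₀ (one_le_halfLineProb_den_div hlam hne ht)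

/-- This is the forward equation `h' = -lam * h + mu * p₁` at the origin, with the geometric value
`p₁ = h * (1 - h)`. -/
theorem hasDerivAt_halfLineProb {lam mu : ℝ} (hlam : 0 < lam) (hne : mu ≠ lam) {t : ℝ}
    (ht : 0 ≤ t) : HasDerivAt (halfLineProb lam mu)
      (halfLineProb lam mu t * (mu - lam - mu * halfLineProb lam mu t)) t := by
  have h1 := one_le_halfLineProb_den_div hlam hne ht
  have h2 : mu - lam * Real.exp (-((mu - lam) * t)) ≠ 0 := by
    intro h
    rw [h, zero_div] at h1
    linarith
  have h3 : HasDerivAt (fun s => mu - lam * Real.exp (-((mu - lam) * s)))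
      (lam * (mu - lam) * Real.exp (-((mu - lam) * t))) t := by
    have := (((hasDerivAt_id t).const_mul (mu - lam)).neg.exp.const_mul lam).const_sub mu
    refine this.congr_deriv ?_
    simp
    ring
  refine ((hasDerivAt_const t (mu - lam)).div h3 h2).congr_deriv ?_
  unfold halfLineProb
  field_simp
  ring

theorem spiderG_eq {lam mu : ℝ} (hlam : 0 < lam) (hne : mu ≠ lam) :
    spiderG lam lam mu = fun t => 1 - halfLineProb lam mu t := by
  funext t
  have e : Real.exp (-((mu - lam) * t)) * Real.exp (-((lam - mu) * t)) = 1 := by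
    rw [← Real.exp_add, ← Real.exp_zero]
    congr 1
    ring
  rw [spiderG, spiderH, if_neg hne.symm, div_self hlam.ne', Real.rpow_one, halfLineProb,
    ← mul_div_mul_right (mu - lam) _ (Real.exp_pos (-((lam - mu) * t))).ne', ← neg_div_neg_eq]
  congr 2
  · ring
  · linear_combination lam * e

theorem deriv_spiderG {lam mu : ℝ} (hlam : 0 < lam) (hne : mu ≠ lam) {t : ℝ} (ht : 0 ≤ t) :
    deriv (spiderG lam lam mu) t =
      -(halfLineProb lam mu t * (mu - lam - mu * halfLineProb lam mu t)) := by
  rw [spiderG_eq hlam hne]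
  exact ((hasDerivAt_halfLineProb hlam hne ht).const_sub 1).deriv

theorem continuousOn_deriv_spiderG {lam mu : ℝ} (hlam : 0 < lam) (hne : mu ≠ lam) :
    ContinuousOn (deriv (spiderG lam lam mu)) (Set.Ici 0) := by
  have h : ContinuousOn (halfLineProb lam mu) (Set.Ici 0) := fun t ht =>
    (hasDerivAt_halfLineProb hlam hne ht).continuousAt.continuousWithinAt
  have h2 : ContinuousOn (fun t => -(halfLineProb lam mu t *
      (mu - lam - mu * halfLineProb lam mu t))) (Set.Ici 0) :=
    (h.mul (continuousOn_const.sub (continuousOn_const.mul h))).neg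
  exact h2.congr fun t ht => deriv_spiderG hlam hne ht

/-! ### The Volterra equation for the walk on the spider. -/

theorem Spider.sum_rate_origin {d : ℕ} (α lam mu : ℝ) [DecidableEq (Spider d)]
    (g : Spider d → ℝ) :
    ∑ w ∈ insert Spider.origin (Finset.univ.image fun j : Fin d => Spider.ray j 0),
      Spider.rate d α lam mu .origin w * g w =
        -(d * α) * g .origin + α * ∑ j : Fin d, g (.ray j 0) := by
  rw [Finset.sum_insert (by simp), Finset.sum_image (by intro i _ j _ h; simpa using h),
    Finset.mul_sum]
  simp [Spider.rate]

theorem Spider.sum_rate_ray_zero {d : ℕ} (α lam mu : ℝ) [DecidableEq (Spider d)] (j : Fin d)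
    (g : Spider d → ℝ) :
    ∑ w ∈ ({.origin, .ray j 0, .ray j 1} : Finset (Spider d)),
      Spider.rate d α lam mu (.ray j 0) w * g w =
        (α + lam) * (g (.ray j 1) - g (.ray j 0)) + mu * (g .origin - g (.ray j 0)) := by
  rw [Finset.sum_insert (by simp), Finset.sum_insert (by simp), Finset.sum_singleton]
  simp [Spider.rate]
  ring

theorem Spider.sum_rate_ray_succ {d : ℕ} (α lam mu : ℝ) [DecidableEq (Spider d)] (j : Fin d)
    (k : ℕ) (g : Spider d → ℝ) :
    ∑ w ∈ ({.ray j k, .ray j (k + 1), .ray j (k + 2)} : Finset (Spider d)),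
      Spider.rate d α lam mu (.ray j (k + 1)) w * g w =
        (α + lam * (k + 2)) * (g (.ray j (k + 2)) - g (.ray j (k + 1))) +
          mu * (k + 2) * (g (.ray j k) - g (.ray j (k + 1))) := by
  rw [Finset.sum_insert (by simp), Finset.sum_insert (by simp), Finset.sum_singleton]
  have h1 : k ≠ k + 1 + 1 := by omega
  simp [Spider.rate, h1]
  ring

/-- The probability of being at the origin at time `t`, averaged over the initial states at
distance `k` from the origin. -/
noncomputable def meanReturn {d : ℕ} (T : ℝ≥0 → Spider d → Spider d → ℝ) : ℕ → ℝ → ℝ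
  | 0, t => T t.toNNReal .origin .origin
  | k + 1, t => (d : ℝ)⁻¹ * ∑ j : Fin d, T t.toNNReal (.ray j k) .origin

-- The equation at the origin involves the semiaxes only through their sum, so averaging over them
-- closes the system without any symmetry of `T`.
open Classical in
theorem transition_volterra {d : ℕ} (hd : 1 ≤ d) {lam mu : ℝ} (hlam : 0 < lam) (hne : mu ≠ lam)
    {T : ℝ≥0 → Spider d → Spider d → ℝ} (hT : IsTransitionFunction T)
    (hq : HasTransitionRates T (Spider.rate d lam lam mu)) {t : ℝ} (ht : 0 ≤ t) :
    SatisfiesVolterra d lam lam mu (fun s => T s.toNNReal .origin .origin) t := by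
  have hd0 : (d : ℝ) ≠ 0 := by
    have : d ≠ 0 := by omega
    exact_mod_cast this
  have hcT : ∀ u, Continuous fun s : ℝ => T s.toNNReal u .origin := fun u =>
    (hT.continuous hq u .origin).comp continuous_real_toNNReal
  have hc : ContinuousOn (fun y => deriv (spiderG lam lam mu) (t - y) *
      T y.toNNReal .origin .origin) (Set.Icc 0 t) :=
    ((continuousOn_deriv_spiderG hlam hne).comp (f := fun y => t - y) (by fun_prop)
      fun y hy => sub_nonneg.2 hy.2).mul (hcT _).continuousOn
  refine ⟨hc.intervalIntegrable_of_Icc ht, ?_⟩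
  have key := volterra_of_backward (lam := lam) (mu := mu) (d := d) (h := halfLineProb lam mu)
    (fun s hs => hasDerivAt_halfLineProb hlam hne hs) (halfLineProb_zero hne)
    (fun s hs => halfLineProb_pos hlam hne hs) (fun s hs => halfLineProb_le_one hlam hne hs)
    (a := meanReturn T) ?_ ?_ ?_ ?_ ?_ ?_ ht
  · simp only [meanReturn] at key
    have hG : 1 - spiderG lam lam mu t = halfLineProb lam mu t := by
      rw [spiderG_eq hlam hne, sub_sub_cancel]
    beta_reduce
    rw [key, hG, sub_eq_add_neg (halfLineProb lam mu t), ← mul_neg,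
      ← intervalIntegral.integral_neg]
    congr 2
    refine intervalIntegral.integral_congr fun y hy => ?_
    rw [Set.uIcc_of_le ht] at hy
    simp only [deriv_spiderG hlam hne (sub_nonneg.2 hy.2)]
    ring
  · intro k r
    cases k with
    | zero =>
      simp only [meanReturn]
      rw [abs_of_nonneg (hT.nonneg _ _ _)]
      exact hT.le_one _ _ _
    | succ k =>
      simp only [meanReturn]
      have h1 : ∑ j : Fin d, T r.toNNReal (.ray j k) .origin ≤ ∑ j : Fin d, 1 :=
        Finset.sum_le_sum fun j _ => hT.le_one _ _ _
      have h2 : 0 ≤ ∑ j : Fin d, T r.toNNReal (.ray j k) .origin :=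
        Finset.sum_nonneg fun j _ => hT.nonneg _ _ _
      rw [abs_of_nonneg (mul_nonneg (by positivity) h2), inv_mul_le_one₀ (by positivity)]
      simpa using h1
  · intro k
    cases k with
    | zero => exact hcT _
    | succ k => exact continuous_const.mul (continuous_finsetSum _ fun j _ => hcT _)
  · simp [meanReturn, hT.zero_self]
  · intro k
    simp [meanReturn, hT.zero_ne]
  · intro r hr
    have h1 := hT.hasDerivWithinAt_backward hq
      (insert Spider.origin (Finset.univ.image fun j : Fin d => Spider.ray j 0))
      (u := .origin) (by simp) ?_ .origin hr
    · refine h1.congr_deriv ?_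
      rw [Spider.sum_rate_origin]
      simp only [meanReturn]
      field_simp
      ring
    · have := Spider.sum_rate_origin (d := d) lam lam mu fun _ => 1
      simp only [mul_one] at this
      rw [this]
      simp
      ring
  · intro k r hr
    -- `ray j k` is at distance `k + 1`; the `if` names its inner neighbour, which for `k = 0` is
    -- the common origin.
    have h1 : ∀ j : Fin d, HasDerivWithinAt (fun r : ℝ => T r.toNNReal (.ray j k) .origin)
        (lam * (k + 2) * (T r.toNNReal (.ray j (k + 1)) .origin - T r.toNNReal (.ray j k) .origin) +
          mu * (k + 1) * (T r.toNNReal (if k = 0 then .origin else .ray j (k - 1)) .origin -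
            T r.toNNReal (.ray j k) .origin)) (Set.Ioi r) r := by
      intro j
      cases k with
      | zero =>
        have h2 := hT.hasDerivWithinAt_backward hq {.origin, .ray j 0, .ray j 1}
          (u := .ray j 0) (by simp) ?_ .origin hr
        · refine h2.congr_deriv ?_
          rw [Spider.sum_rate_ray_zero]
          simp only [Nat.cast_zero, if_true]
          ring
        · have := Spider.sum_rate_ray_zero (d := d) lam lam mu j fun _ => 1
          simp only [mul_one, sub_self, mul_zero, add_zero] at this
          exact this
      | succ k =>
        have h2 := hT.hasDerivWithinAt_backward hq {.ray j k, .ray j (k + 1), .ray j (k + 2)}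
          (u := .ray j (k + 1)) (by simp) ?_ .origin hr
        · refine h2.congr_deriv ?_
          rw [Spider.sum_rate_ray_succ]
          simp
          ring
        · have := Spider.sum_rate_ray_succ (d := d) lam lam mu j k fun _ => 1
          simp only [mul_one] at this
          rw [this]
          simp
    have h2 := (HasDerivWithinAt.fun_sum fun j (_ : j ∈ Finset.univ) => h1 j).const_mul (d : ℝ)⁻¹
    have e : (d : ℝ)⁻¹ * ∑ j : Fin d, T r.toNNReal (if k = 0 then .origin else .ray j (k - 1))
        .origin = meanReturn T k r := by
      cases k with
      | zero =>
        simp [meanReturn, hd0]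
      | succ k => simp [meanReturn]
    refine h2.congr_deriv ?_
    rw [Finset.sum_add_distrib, ← Finset.mul_sum, ← Finset.mul_sum, Finset.sum_sub_distrib,
      Finset.sum_sub_distrib, ← e]
    simp only [meanReturn]
    ring

/-! ### Uniqueness, and reduction of the process to its transition function. -/

/-- Uniqueness for a Volterra equation of convolution type. -/
theorem eq_zero_of_volterra {c t : ℝ} {κ e : ℝ → ℝ} (hκ : ContinuousOn κ (Set.Icc 0 t))
    (he : ContinuousOn e (Set.Icc 0 t))
    (h : ∀ s ∈ Set.Icc 0 t, e s = c * ∫ y in (0 : ℝ)..s, κ (s - y) * e y) :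
    ∀ s ∈ Set.Icc 0 t, e s = 0 := by
  intro s₀ hs₀
  have ht : 0 ≤ t := hs₀.1.trans hs₀.2
  obtain ⟨M, hM⟩ := isCompact_Icc.exists_bound_of_continuousOn hκ
  -- The extension of `|e|` is continuous on the whole line, so its primitive `u` is differentiable
  -- everywhere, and Grönwall applies to `u' ≤ |c| * M * u`.
  set E : ℝ → ℝ := Set.IccExtend ht (Set.domRestrict (Set.Icc 0 t) fun y => |e y|) with hE
  have hEc : Continuous E := (continuousOn_iff_continuous_domRestrict.1 he.abs).Icc_extend'
  have hEe : ∀ s ∈ Set.Icc 0 t, E s = |e s| := fun s hs => by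
    rw [hE, Set.IccExtend_of_mem _ _ hs]
    rfl
  have hE0 : ∀ s, 0 ≤ E s := fun s => abs_nonneg _
  set u : ℝ → ℝ := fun s => ∫ y in (0 : ℝ)..s, E y with hu
  have hud : ∀ s, HasDerivAt u (E s) s := fun s => hEc.integral_hasStrictDerivAt 0 s |>.hasDerivAt
  have hu0 : ∀ s, 0 ≤ s → 0 ≤ u s := fun s hs =>
    intervalIntegral.integral_nonneg hs fun y _ => hE0 y
  have hb : ∀ s ∈ Set.Icc 0 t, E s ≤ |c| * M * u s := by
    intro s hs
    rw [hEe s hs, h s hs, abs_mul, mul_assoc]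
    refine mul_le_mul_of_nonneg_left ?_ (abs_nonneg c)
    rw [hu, ← intervalIntegral.integral_const_mul, ← Real.norm_eq_abs]
    refine intervalIntegral.norm_integral_le_of_norm_le hs.1 ?_
      ((hEc.const_mul M).intervalIntegrable _ _)
    refine Filter.Eventually.of_forall fun y hy => ?_
    rw [norm_mul, hEe y ⟨hy.1.le, hy.2.trans hs.2⟩]
    exact mul_le_mul_of_nonneg_right (hM _ ⟨sub_nonneg.2 hy.2, by linarith [hy.1, hs.2]⟩)
      (abs_nonneg _)
  have hg := norm_le_gronwallBound_of_norm_deriv_right_le (f := u) (f' := E) (δ := 0)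
    (K := |c| * M) (ε := 0) (a := 0) (b := t)
    (fun s _ => (hud s).continuousAt.continuousWithinAt) (fun s _ => (hud s).hasDerivWithinAt)
    (by simp [hu]) (fun s hs => by
      rw [add_zero, Real.norm_of_nonneg (hE0 s), Real.norm_of_nonneg (hu0 s hs.1)]
      exact hb s ⟨hs.1, hs.2.le⟩) s₀ hs₀
  rw [gronwallBound_ε0, zero_mul] at hg
  have h1 : u s₀ = 0 := norm_le_zero_iff.1 hg
  have h2 := hb s₀ hs₀
  rw [h1, mul_zero, hEe _ hs₀] at h2
  exact abs_nonpos_iff.1 h2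

theorem originProb_eq {d : ℕ} {Ω : Type*} [MeasurableSpace Ω]
    {P : MeasureTheory.Measure Ω} [MeasureTheory.IsProbabilityMeasure P]
    {N : ℝ≥0 → Ω → Spider d} {T : ℝ≥0 → Spider d → Spider d → ℝ}
    (h0 : ∀ᵐ ω ∂P, N 0 ω = Spider.origin) (hT : HasMarkovTransition P N T) :
    originProb P N = fun t => T t.toNNReal .origin .origin := by
  funext t
  have h1 := hT 0 t.toNNReal .origin .origin Set.univ MeasurableSet.univ
  have h2 : P.real {ω | N 0 ω = Spider.origin} = 1 := by
    rw [MeasureTheory.measureReal_congr (Filter.eventuallyEq_univ.2 h0)]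
    simp
  rw [Set.univ_inter, zero_add, h2, one_mul] at h1
  rw [← h1, originProb]
  refine MeasureTheory.measureReal_congr ?_
  filter_upwards [h0] with ω hω
  have : (N 0 ω = Spider.origin ∧ N t.toNNReal ω = Spider.origin) =
      (N t.toNNReal ω = Spider.origin) := by simp [hω]
  exact this.symm

/-! ### Eulerian polynomials as Taylor coefficients of the return probability. -/

theorem aeval_eulerianPoly_succ (n : ℕ) (y : ℂ) :
    Polynomial.aeval y (eulerianPoly (n + 1)) =
      (1 + n * y) * Polynomial.aeval y (eulerianPoly n) +
        y * (1 - y) * Polynomial.aeval y (Polynomial.derivative (eulerianPoly n)) := by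
  simp [eulerianPoly]

/-- The function `A_n(y) y / (1 - y) ^ (n + 1)`, which is `(y d/dy) ^ n` applied to
`y / (1 - y)`. -/
noncomputable def eulerianFrac (n : ℕ) (y : ℂ) : ℂ :=
  y * Polynomial.aeval y (eulerianPoly n) / (1 - y) ^ (n + 1)

theorem hasDerivAt_eulerianFrac (n : ℕ) {r y : ℂ} {f : ℂ → ℂ} {z : ℂ} (hf : f z = y)
    (hd : HasDerivAt f (r * y) z) (hy : y ≠ 1) :
    HasDerivAt (fun z => eulerianFrac n (f z)) (r * eulerianFrac (n + 1) y) z := by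
  have h1 : 1 - y ≠ 0 := sub_ne_zero.2 hy.symm
  have h2 : HasDerivAt (eulerianFrac n) (((1 * Polynomial.aeval y (eulerianPoly n) +
      y * Polynomial.aeval y (Polynomial.derivative (eulerianPoly n))) * (1 - y) ^ (n + 1) -
      y * Polynomial.aeval y (eulerianPoly n) * ((n + 1 : ℕ) * (1 - y) ^ n * (-1))) /
        ((1 - y) ^ (n + 1)) ^ 2) y :=
    ((hasDerivAt_id y).mul ((eulerianPoly n).hasDerivAt_aeval y)).div
      (((hasDerivAt_id y).const_sub 1).pow (n + 1)) (pow_ne_zero _ h1)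
  rw [← hf] at h2
  refine (h2.comp z hd).congr_deriv ?_
  rw [hf, eulerianFrac, aeval_eulerianPoly_succ]
  field_simp
  push_cast
  ring

/-- The analytic continuation of `halfLineProb`. -/
noncomputable def halfLineProbC (lam mu : ℝ) (z : ℂ) : ℂ :=
  (1 - mu / lam) / (mu / lam) * eulerianFrac 0 (mu / lam * Complex.exp ((mu - lam) * z))

theorem hasDerivAt_exp_scaled (x r z : ℂ) :
    HasDerivAt (fun z => x * Complex.exp (r * z)) (r * (x * Complex.exp (r * z))) z := by
  refine ((((hasDerivAt_id z).const_mul r).cexp).const_mul x).congr_deriv ?_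
  simp
  ring

/-- With `y = (mu / lam) * exp ((mu - lam) * z)`, the operator `d/dz` is `(mu - lam) * y d/dy`,
which raises the index of `eulerianFrac`. -/
theorem iteratedDeriv_halfLineProbC (lam mu : ℝ) (n : ℕ) {z : ℂ}
    (hz : (mu / lam : ℂ) * Complex.exp ((mu - lam) * z) ≠ 1) :
    iteratedDeriv n (halfLineProbC lam mu) z = (mu - lam) ^ n * ((1 - mu / lam) / (mu / lam) *
      eulerianFrac n (mu / lam * Complex.exp ((mu - lam) * z))) := by
  induction n generalizing z with
  | zero => simp [halfLineProbC]
  | succ n ih =>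
    have hc : Continuous fun z : ℂ => (mu / lam : ℂ) * Complex.exp ((mu - lam) * z) := by
      fun_prop
    have hev : iteratedDeriv n (halfLineProbC lam mu) =ᶠ[𝓝 z] fun z =>
        (mu - lam) ^ n * ((1 - mu / lam) / (mu / lam) *
          eulerianFrac n (mu / lam * Complex.exp ((mu - lam) * z))) := by
      filter_upwards [hc.continuousAt.eventually_ne hz] with w hw
      exact ih hw
    rw [iteratedDeriv_succ, hev.deriv_eq]
    have h1 := hasDerivAt_eulerianFrac n rfl (hasDerivAt_exp_scaled (mu / lam) (mu - lam) z) hz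
    rw [((h1.const_mul _).const_mul _).deriv]
    ring

/-- A pole has `-z.re = log (mu / lam) / (mu - lam)`, by taking norms; so none lies in the disc, and
the bound on `t` is a radius of convergence. -/
theorem exp_scaled_ne_one {lam mu : ℝ} (hlam : 0 < lam) (hmu : 0 < mu) (hne : mu ≠ lam) {z : ℂ}
    (hz : ‖z‖ < Real.log (mu / lam) / (mu - lam)) :
    (mu / lam : ℂ) * Complex.exp ((mu - lam) * z) ≠ 1 := by
  intro h
  have h0 : mu - lam ≠ 0 := sub_ne_zero.2 hne
  have h1 : (mu / lam) * Real.exp (((mu - lam) * z : ℂ).re) = 1 := by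
    have := congrArg norm h
    rw [norm_mul, norm_div, Complex.norm_exp, Complex.norm_real, Complex.norm_real,
      Real.norm_of_nonneg hmu.le, Real.norm_of_nonneg hlam.le, norm_one] at this
    exact this
  have h2 : Real.log (mu / lam) + ((mu - lam) * z : ℂ).re = 0 := by
    have := congrArg Real.log h1
    rwa [Real.log_mul (by positivity) (Real.exp_pos _).ne', Real.log_exp, Real.log_one] at this
  have h3 : ((mu - lam) * z : ℂ).re = (mu - lam) * z.re := by simp
  have h4 : Real.log (mu / lam) / (mu - lam) = -z.re := by
    rw [div_eq_iff h0]
    linarith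
  rw [h4] at hz
  have := Complex.abs_re_le_norm z
  have := neg_abs_le z.re
  linarith

theorem differentiableAt_halfLineProbC {lam mu : ℝ} {z : ℂ}
    (hz : (mu / lam : ℂ) * Complex.exp ((mu - lam) * z) ≠ 1) :
    DifferentiableAt ℂ (halfLineProbC lam mu) z :=
  ((hasDerivAt_eulerianFrac 0 rfl (hasDerivAt_exp_scaled (mu / lam) (mu - lam) z) hz).const_mul
    _).differentiableAt

theorem eulerianFrac_ofReal (lam mu t : ℝ) :
    (1 - mu / lam : ℂ) / (mu / lam) = (((1 - mu / lam) / (mu / lam) : ℝ) : ℂ) ∧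
    (mu / lam : ℂ) * Complex.exp ((mu - lam) * t) =
      ((mu / lam * Real.exp ((mu - lam) * t) : ℝ) : ℂ) := by
  constructor <;> push_cast <;> rfl

theorem real_exp_scaled_ne_one {lam mu : ℝ} (hlam : 0 < lam) (hmu : 0 < mu) (hne : mu ≠ lam)
    {t : ℝ} (ht : |t| < Real.log (mu / lam) / (mu - lam)) :
    lam - mu * Real.exp ((mu - lam) * t) ≠ 0 := by
  intro h
  have h1 := exp_scaled_ne_one hlam hmu hne (z := t) (by rwa [Complex.norm_real])
  rw [(eulerianFrac_ofReal lam mu t).2] at h1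
  apply h1
  rw [div_mul_eq_mul_div, ← sub_eq_zero.1 h, div_self hlam.ne', Complex.ofReal_one]

theorem halfLineProb_eq_div (lam mu t : ℝ) : halfLineProb lam mu t =
    (lam - mu) * Real.exp ((mu - lam) * t) / (lam - mu * Real.exp ((mu - lam) * t)) := by
  have e : Real.exp (-((mu - lam) * t)) * Real.exp ((mu - lam) * t) = 1 := by
    rw [← Real.exp_add]
    simp
  rw [halfLineProb, ← mul_div_mul_right (mu - lam) _ (Real.exp_pos ((mu - lam) * t)).ne',
    ← neg_div_neg_eq]
  congr 1
  · ring
  · linear_combination lam * e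

theorem one_sub_div_mul {a b e : ℝ} (hb : b ≠ 0) : 1 - a / b * e = (b - a * e) / b := by
  field_simp

theorem halfLineProbC_ofReal {lam mu : ℝ} (hlam : 0 < lam) (hmu : 0 < mu) (hne : mu ≠ lam)
    {t : ℝ} (ht : |t| < Real.log (mu / lam) / (mu - lam)) :
    halfLineProbC lam mu t = (halfLineProb lam mu t : ℝ) := by
  have h := real_exp_scaled_ne_one hlam hmu hne ht
  rw [halfLineProbC, (eulerianFrac_ofReal lam mu t).1, (eulerianFrac_ofReal lam mu t).2,
    halfLineProb_eq_div]
  simp only [eulerianFrac, eulerianPoly, map_one, mul_one, zero_add, pow_one]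
  have h1 : 1 - mu / lam * Real.exp ((mu - lam) * t) ≠ 0 := by
    rw [one_sub_div_mul hlam.ne']
    exact div_ne_zero h hlam.ne'
  norm_cast
  field_simp

theorem deriv_halfLineProbC_ofReal {lam mu : ℝ} (hlam : 0 < lam) (hmu : 0 < mu) (hne : mu ≠ lam)
    {t : ℝ} (ht : |t| < Real.log (mu / lam) / (mu - lam)) :
    deriv (halfLineProbC lam mu) t =
      ((halfLineProb lam mu t * (mu - lam - mu * halfLineProb lam mu t) : ℝ) : ℂ) := by
  have h := real_exp_scaled_ne_one hlam hmu hne ht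
  rw [← iteratedDeriv_one, iteratedDeriv_halfLineProbC lam mu 1
    (exp_scaled_ne_one hlam hmu hne (by rwa [Complex.norm_real])),
    (eulerianFrac_ofReal lam mu t).1, (eulerianFrac_ofReal lam mu t).2, halfLineProb_eq_div]
  simp only [eulerianFrac, aeval_eulerianPoly_succ 0]
  simp only [eulerianPoly, map_one, mul_one, Polynomial.derivative_one, map_zero, mul_zero,
    add_zero, Nat.cast_zero, zero_mul, pow_one, Nat.reduceAdd]
  norm_cast
  have hl := hlam.ne'
  have hm := hmu.ne'
  rw [one_sub_div_mul hl, one_sub_div hl]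
  generalize Real.exp ((mu - lam) * t) = e at h ⊢
  field_simp
  ring

theorem iteratedDeriv_halfLineProbC_zero {lam mu : ℝ} (hlam : 0 < lam) (hmu : 0 < mu)
    (hne : mu ≠ lam) (n : ℕ) :
    iteratedDeriv n (halfLineProbC lam mu) 0 =
      (((-lam) ^ n * (eulerianPoly n).eval (mu / lam) : ℝ) : ℂ) := by
  have hx : 1 - mu / lam ≠ 0 := by
    rw [one_sub_div hlam.ne']
    exact div_ne_zero (sub_ne_zero.2 hne.symm) hlam.ne'
  have hxC : (mu / lam : ℂ) ≠ 1 := by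
    norm_cast
    intro h
    exact hx (by rw [h, sub_self])
  rw [iteratedDeriv_halfLineProbC lam mu n (by simpa using hxC), (eulerianFrac_ofReal lam mu 0).1]
  have e : Polynomial.aeval (((mu / lam : ℝ) : ℂ)) (eulerianPoly n) =
      (((eulerianPoly n).eval (mu / lam) : ℝ) : ℂ) := by
    rw [← Complex.coe_algebraMap, Polynomial.aeval_algebraMap_apply, Polynomial.aeval_def,
      Polynomial.eval₂_eq_eval_map]
    simp
  simp only [mul_zero, Complex.exp_zero, mul_one, eulerianFrac]
  rw [← Complex.ofReal_div, e]
  norm_cast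
  -- This factor cancels the powers of `1 - mu / lam` in `eulerianFrac`.
  have h2 : mu - lam = -lam * (1 - mu / lam) := by
    field_simp
    ring
  have h3 : mu / lam ≠ 0 := by positivity
  rw [h2, mul_pow]
  generalize 1 - mu / lam = p at hx ⊢
  field_simp
  ring

/-- The exponential generating function of the numbers `A_n(mu / lam)`. -/
theorem hasSum_halfLineProb {lam mu : ℝ} (hlam : 0 < lam) (hmu : 0 < mu) (hne : mu ≠ lam)
    {t : ℝ} (ht : |t| < Real.log (mu / lam) / (mu - lam)) :
    HasSum (fun n : ℕ => (-lam) ^ n * (eulerianPoly n).eval (mu / lam) * (t ^ n / n.factorial))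
      (halfLineProb lam mu t) := by
  have hd : DifferentiableOn ℂ (halfLineProbC lam mu)
      (Metric.ball 0 (Real.log (mu / lam) / (mu - lam))) := fun z hz =>
    (differentiableAt_halfLineProbC (exp_scaled_ne_one hlam hmu hne
      (mem_ball_zero_iff.1 hz))).differentiableWithinAt
  have h1 := Complex.hasSum_taylorSeries_on_ball hd (z := t)
    (mem_ball_zero_iff.2 (by rwa [Complex.norm_real]))
  rw [halfLineProbC_ofReal hlam hmu hne ht] at h1
  rw [← Complex.hasSum_ofReal]
  refine h1.congr_fun fun n => ?_
  rw [iteratedDeriv_halfLineProbC_zero hlam hmu hne]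
  simp
  ring

theorem hasSum_deriv_halfLineProb {lam mu : ℝ} (hlam : 0 < lam) (hmu : 0 < mu) (hne : mu ≠ lam)
    {t : ℝ} (ht : |t| < Real.log (mu / lam) / (mu - lam)) :
    HasSum (fun n : ℕ => (-lam) ^ (n + 1) * (eulerianPoly (n + 1)).eval (mu / lam) *
      (t ^ n / n.factorial))
      (halfLineProb lam mu t * (mu - lam - mu * halfLineProb lam mu t)) := by
  have hd : DifferentiableOn ℂ (halfLineProbC lam mu)
      (Metric.ball 0 (Real.log (mu / lam) / (mu - lam))) := fun z hz =>
    (differentiableAt_halfLineProbC (exp_scaled_ne_one hlam hmu hne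
      (mem_ball_zero_iff.1 hz))).differentiableWithinAt
  have h1 := Complex.hasSum_taylorSeries_on_ball (hd.deriv Metric.isOpen_ball) (z := t)
    (mem_ball_zero_iff.2 (by rwa [Complex.norm_real]))
  rw [deriv_halfLineProbC_ofReal hlam hmu hne ht] at h1
  rw [← Complex.hasSum_ofReal]
  refine h1.congr_fun fun n => ?_
  rw [← iteratedDeriv_succ', iteratedDeriv_halfLineProbC_zero hlam hmu hne]
  simp
  ring

/-! ### Formal power series and the renewal coefficients. -/

/-- The power series `∑_{n ≥ 2} A_n(x) X ^ n`. -/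
noncomputable def eulerianSeriesTail (x : ℝ) : PowerSeries ℝ :=
  PowerSeries.mk fun n => if 2 ≤ n then (eulerianPoly n).eval x else 0

/-- The power series `∑_{n ≥ 1} A_n(x) X ^ n`. -/
noncomputable def eulerianSeries (x : ℝ) : PowerSeries ℝ :=
  eulerianSeriesTail x + PowerSeries.X

theorem eulerianPoly_one : eulerianPoly 1 = 1 := by
  simp [eulerianPoly]

theorem coeff_zero_eulerianSeries (x : ℝ) : PowerSeries.coeff 0 (eulerianSeries x) = 0 := by
  simp [eulerianSeries, eulerianSeriesTail]

theorem coeff_succ_eulerianSeries (n : ℕ) (x : ℝ) :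
    PowerSeries.coeff (n + 1) (eulerianSeries x) = (eulerianPoly (n + 1)).eval x := by
  rw [eulerianSeries, eulerianSeriesTail, map_add, PowerSeries.coeff_mk, PowerSeries.coeff_X]
  cases n with
  | zero => simp [eulerianPoly_one]
  | succ n => simp

theorem coeff_eulerianSeriesTail_pow (j m : ℕ) (x : ℝ) :
    PowerSeries.coeff m (eulerianSeriesTail x ^ j) = eulerianQ j m x := by
  have h1 : eulerianSeriesTail x ^ j = ∏ _i : Fin j, eulerianSeriesTail x := by simp
  rw [h1, PowerSeries.coeff_prod, eulerianQ, Finset.sum_filter]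
  refine Finset.sum_equiv Finsupp.equivFunOnFinite (fun l => ?_) fun l _ => ?_
  · simp [Finset.Nat.mem_antidiagonalTuple]
  · simp only [eulerianSeriesTail, PowerSeries.coeff_mk, Finset.prod_ite_zero]
    simp

theorem eulerianQ_zero (m : ℕ) (x : ℝ) : eulerianQ 0 m x = if m = 0 then 1 else 0 := by
  rw [← coeff_eulerianSeriesTail_pow, pow_zero, PowerSeries.coeff_one]

theorem eulerianQ_eq_zero {j m : ℕ} (h : m < j) (x : ℝ) : eulerianQ j (j + m) x = 0 := by
  refine Finset.sum_eq_zero fun s hs => ?_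
  rw [Finset.mem_filter, Finset.Nat.mem_antidiagonalTuple] at hs
  have h1 : ∑ _i : Fin j, 2 ≤ ∑ i, s i := Finset.sum_le_sum fun i _ => hs.2 i
  simp at h1
  omega

/-- Choose which `j` of the `k + 1` factors contribute the tail; the others contribute `X`. The
range of `j` may end at `m` instead of `k + 1`: `Q` vanishes for `j > m`, since all `s_i ≥ 2`, and
the binomial for `j > k + 1`. -/
theorem coeff_eulerianSeries_pow (k m : ℕ) (x : ℝ) :
    PowerSeries.coeff (k + 1 + m) (eulerianSeries x ^ (k + 1)) =
      (if m = 0 then 1 else 0) +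
        ∑ j ∈ Finset.Icc 1 m, ((k + 1).choose j : ℝ) * eulerianQ j (j + m) x := by
  have h1 : PowerSeries.coeff (k + 1 + m) (eulerianSeries x ^ (k + 1)) =
      ∑ j ∈ Finset.range (k + 2), ((k + 1).choose j : ℝ) * eulerianQ j (j + m) x := by
    rw [eulerianSeries, add_pow, map_sum]
    refine Finset.sum_congr rfl fun j hj => ?_
    rw [Finset.mem_range] at hj
    rw [← map_natCast (PowerSeries.C (R := ℝ)), PowerSeries.coeff_mul_C,
      PowerSeries.coeff_mul_X_pow', if_pos (by omega), coeff_eulerianSeriesTail_pow, mul_comm]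
    congr 2
    omega
  have h2 : Finset.range (k + 2) = insert 0 (Finset.Icc 1 (k + 1)) := by
    ext j
    simp only [Finset.mem_range, Finset.mem_insert, Finset.mem_Icc]
    omega
  rw [h1, h2, Finset.sum_insert (by simp), zero_add, eulerianQ_zero, Nat.choose_zero_right,
    Nat.cast_one, one_mul]
  congr 1
  rw [Finset.sum_subset (Finset.Icc_subset_Icc_right (le_max_left (k + 1) m)),
    Finset.sum_subset (Finset.Icc_subset_Icc_right (le_max_right (k + 1) m))]
  · intro j hj hj'
    rw [Finset.mem_Icc] at hj hj'
    rw [eulerianQ_eq_zero (by omega), mul_zero]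
  · intro j hj hj'
    rw [Finset.mem_Icc] at hj hj'
    rw [Nat.choose_eq_zero_of_lt (by omega), Nat.cast_zero, zero_mul]

theorem coeff_eulerianSeries_pow_eq_zero {k n : ℕ} (h : n < k) (x : ℝ) :
    PowerSeries.coeff n (eulerianSeries x ^ k) = 0 := by
  have h1 : (PowerSeries.X : PowerSeries ℝ) ∣ eulerianSeries x := by
    rw [PowerSeries.X_dvd_iff, ← PowerSeries.coeff_zero_eq_constantCoeff_apply]
    exact coeff_zero_eulerianSeries x
  exact PowerSeries.X_pow_dvd_iff.1 (pow_dvd_pow_of_dvd h1 k) n h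

/-- The coefficients of `∑_k c ^ k B ^ (k + 1)` with `B = ∑_{n ≥ 1} A_n(x) X ^ n`. -/
noncomputable def renewalCoeff (c x : ℝ) (n : ℕ) : ℝ :=
  ∑ k ∈ Finset.range n, c ^ k * PowerSeries.coeff n (eulerianSeries x ^ (k + 1))

/-- `B` has no constant term, so higher powers do not reach degree `n`. One truncation thus serves
all degrees in a Cauchy product. -/
theorem renewalCoeff_eq_of_le (c x : ℝ) {n N : ℕ} (h : n ≤ N) : renewalCoeff c x n =
    PowerSeries.coeff n (∑ k ∈ Finset.range N, PowerSeries.C (c ^ k) * eulerianSeries x ^ (k + 1)) := by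
  rw [renewalCoeff, map_sum, Finset.sum_subset (Finset.range_mono h)]
  · exact Finset.sum_congr rfl fun k _ => (PowerSeries.coeff_C_mul _ _ _).symm
  · intro k _ hk
    rw [Finset.mem_range, not_lt] at hk
    rw [coeff_eulerianSeries_pow_eq_zero (by omega), mul_zero]

/-- With `R = ∑ c ^ k B ^ (k + 1)` this is `R = B + c B R` read at degree `n + 1`. -/
theorem renewalCoeff_succ (c x : ℝ) (n : ℕ) : renewalCoeff c x (n + 1) =
    (eulerianPoly (n + 1)).eval x + c * ∑ p ∈ Finset.HasAntidiagonal.antidiagonal n,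
      (eulerianPoly (p.1 + 1)).eval x * renewalCoeff c x p.2 := by
  have h1 : ∑ p ∈ Finset.HasAntidiagonal.antidiagonal n, (eulerianPoly (p.1 + 1)).eval x * renewalCoeff c x p.2 =
      PowerSeries.coeff (n + 1) (eulerianSeries x *
        ∑ k ∈ Finset.range n, PowerSeries.C (c ^ k) * eulerianSeries x ^ (k + 1)) := by
    rw [PowerSeries.coeff_mul, Finset.Nat.sum_antidiagonal_succ, coeff_zero_eulerianSeries,
      zero_mul, zero_add]
    refine Finset.sum_congr rfl fun p hp => ?_
    rw [coeff_succ_eulerianSeries, renewalCoeff_eq_of_le c x (Finset.HasAntidiagonal.antidiagonal.snd_le hp)]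
  rw [h1, renewalCoeff, Finset.sum_range_succ', Finset.mul_sum, map_sum, Finset.mul_sum, add_comm]
  congr 1
  · simp [coeff_succ_eulerianSeries]
  · refine Finset.sum_congr rfl fun k _ => ?_
    rw [mul_left_comm, PowerSeries.coeff_C_mul, ← pow_succ']
    ring

theorem renewalCoeff_add_two (c x : ℝ) (n : ℕ) : renewalCoeff c x (n + 2) =
    (eulerianPoly (n + 2)).eval x + c ^ (n + 1) + ∑ k ∈ Finset.Icc 1 n, c ^ k *
      ∑ j ∈ Finset.Icc 1 (n + 2 - k - 1), ((k + 1).choose j : ℝ) *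
        eulerianQ j (j + (n + 2 - k - 1)) x := by
  have h1 : Finset.range (n + 2) = insert 0 (insert (n + 1) (Finset.Icc 1 n)) := by
    ext j
    simp only [Finset.mem_range, Finset.mem_insert, Finset.mem_Icc]
    omega
  rw [renewalCoeff, h1, Finset.sum_insert (by simp), Finset.sum_insert (by simp)]
  have h3 : PowerSeries.coeff (n + 2) (eulerianSeries x ^ (n + 1 + 1)) = 1 := by
    rw [show n + 2 = n + 1 + 1 + 0 by rfl, coeff_eulerianSeries_pow]
    simp
  rw [h3, mul_one, pow_zero, one_mul, zero_add, pow_one, coeff_succ_eulerianSeries, ← add_assoc]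
  congr 1
  · refine Finset.sum_congr rfl fun k hk => ?_
    rw [Finset.mem_Icc] at hk
    have h2 := coeff_eulerianSeries_pow k (n + 2 - k - 1) x
    rw [if_neg (by omega), zero_add, show k + 1 + (n + 2 - k - 1) = n + 2 by omega] at h2
    rw [h2]

/-! ### Convergence of renewal series and convolution of exponential generating functions. -/

open Filter in
/-- Growth of the solution of a discrete renewal equation for exponential generating functions. -/
theorem summable_of_renewal {c R : ℝ} {β η : ℕ → ℝ}
    (hβ : ∀ t, |t| < R → Summable fun n => β n * (t ^ n / n.factorial))
    (hη : ∀ n, η (n + 1) = β n + c * ∑ p ∈ Finset.HasAntidiagonal.antidiagonal n, β p.1 * η p.2) {t : ℝ}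
    (ht : |t| < R) : Summable fun n => η n * (t ^ n / n.factorial) := by
  obtain ⟨r, hr1, hr2⟩ := exists_between ht
  have hr : 0 < r := (abs_nonneg t).trans_lt hr1
  obtain ⟨C, hC⟩ := (hβ r (by rwa [abs_of_pos hr])).tendsto_atTop_zero.abs.bddAbove_range
  have hC' : ∀ n, |β n| * r ^ n ≤ C * n.factorial := by
    intro n
    have h1 : |β n * (r ^ n / n.factorial)| ≤ C := hC ⟨n, rfl⟩
    have hf : (0 : ℝ) < n.factorial := by positivity
    rwa [abs_mul, abs_of_nonneg (by positivity : 0 ≤ r ^ n / (n.factorial : ℝ)), ← mul_div_assoc, div_le_iff₀ hf] at h1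
  have hC0 : 0 ≤ C := (abs_nonneg _).trans (hC ⟨0, rfl⟩)
  set g : ℕ → ℝ := fun n => |η n| * (r ^ n / n.factorial) with hg
  have hg0 : ∀ n, 0 ≤ g n := fun n => by positivity
  -- The summand `1` absorbs the inhomogeneous term `β n`. Since `i! * j! ≤ (i + j)!`, one gets `S
  -- (n + 1) ≤ (1 + D / (n + 1)) * S n`, whose ratio tends to `1`: the radius of convergence is not
  -- reduced.
  set S : ℕ → ℝ := fun n => 1 + ∑ j ∈ Finset.range (n + 1), g j with hS
  have hS1 : ∀ n, 1 ≤ S n := fun n => by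
    have := Finset.sum_nonneg (s := Finset.range (n + 1)) fun j _ => hg0 j
    simp only [hS]
    linarith
  set D : ℝ := r * C * (1 + |c|) with hD
  have hD0 : 0 ≤ D := by positivity
  have hstep : ∀ n : ℕ, g (n + 1) ≤ D / (n + 1) * S n := by
    intro n
    have hf : (0 : ℝ) < n.factorial := by positivity
    have hp : ∀ p ∈ Finset.HasAntidiagonal.antidiagonal n, |β p.1 * η p.2| * r ^ n ≤ C * n.factorial * g p.2 := by
      intro p hp
      obtain ⟨i, j⟩ := p
      rw [Finset.HasAntidiagonal.mem_antidiagonal] at hp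
      simp only at hp ⊢
      have hij : (i.factorial * j.factorial : ℝ) ≤ n.factorial := by
        rw [← hp]
        exact_mod_cast Nat.factorial_mul_factorial_dvd_factorial_add i j |> Nat.le_of_dvd
          (Nat.factorial_pos _)
      have hgj : |η j| * r ^ j = j.factorial * g j := by
        simp only [hg]
        field_simp
      calc |β i * η j| * r ^ n = (|β i| * r ^ i) * (|η j| * r ^ j) := by
            rw [abs_mul, ← hp, pow_add]
            ring
        _ ≤ (C * i.factorial) * (j.factorial * g j) := by
            rw [hgj]
            exact mul_le_mul_of_nonneg_right (hC' i) (mul_nonneg (by positivity) (hg0 j))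
        _ = C * (i.factorial * j.factorial) * g j := by ring
        _ ≤ C * n.factorial * g j := by
            have := hg0 j
            gcongr
    have hsum : ∑ p ∈ Finset.HasAntidiagonal.antidiagonal n, |β p.1 * η p.2| * r ^ n ≤
        C * n.factorial * ∑ j ∈ Finset.range (n + 1), g j := by
      rw [Finset.mul_sum]
      refine (Finset.sum_le_sum hp).trans_eq ?_
      rw [Finset.Nat.sum_antidiagonal_eq_sum_range_succ_mk, ← Finset.sum_range_reflect]
      refine Finset.sum_congr rfl fun j hj => ?_
      rw [Finset.mem_range] at hj
      simp only
      congr 2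
      omega
    have habs : |η (n + 1)| * r ^ n ≤ C * n.factorial * ((1 + |c|) * S n) := by
      have hs0 : 0 ≤ ∑ j ∈ Finset.range (n + 1), g j := Finset.sum_nonneg fun j _ => hg0 j
      calc |η (n + 1)| * r ^ n
          ≤ (|β n| + |c| * ∑ p ∈ Finset.HasAntidiagonal.antidiagonal n, |β p.1 * η p.2|) * r ^ n := by
            rw [hη]
            refine mul_le_mul_of_nonneg_right ((abs_add_le _ _).trans ?_) (by positivity)
            rw [abs_mul]
            gcongr
            exact Finset.abs_sum_le_sum_abs _ _
        _ = |β n| * r ^ n + |c| * ∑ p ∈ Finset.HasAntidiagonal.antidiagonal n, |β p.1 * η p.2| * r ^ n := by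
            rw [← Finset.sum_mul]
            ring
        _ ≤ C * n.factorial + |c| * (C * n.factorial * ∑ j ∈ Finset.range (n + 1), g j) := by
            exact add_le_add (hC' n) (mul_le_mul_of_nonneg_left hsum (abs_nonneg c))
        _ ≤ C * n.factorial * ((1 + |c|) * S n) := by
            have h1 : 1 + |c| * ∑ j ∈ Finset.range (n + 1), g j ≤ (1 + |c|) * S n := by
              simp only [hS]
              nlinarith [abs_nonneg c]
            have := mul_le_mul_of_nonneg_left h1 (mul_nonneg hC0 hf.le)
            linarith
    have e : g (n + 1) = (|η (n + 1)| * r ^ n) * (r / ((n + 1) * n.factorial)) := by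
      simp only [hg, Nat.factorial_succ]
      push_cast
      ring
    rw [e]
    refine (mul_le_mul_of_nonneg_right habs (by positivity)).trans_eq ?_
    rw [hD]
    field_simp
  set q : ℝ := |t| / r with hq
  have hq0 : 0 ≤ q := by positivity
  have hq1 : q < 1 := (div_lt_one hr).2 hr1
  have hsum : Summable fun n => S n * q ^ n := by
    obtain ⟨ρ, hρ1, hρ2⟩ := exists_between hq1
    refine summable_of_ratio_norm_eventually_le hρ2 ?_
    have hlim : Tendsto (fun n : ℕ => q * (1 + D / ((n : ℝ) + 1))) atTop (𝓝 q) := by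
      have h1 := (tendsto_one_div_add_atTop_nhds_zero_nat (𝕜 := ℝ)).const_mul D
      have h2 := (h1.const_add 1).const_mul q
      simp only [mul_zero, add_zero, mul_one] at h2
      refine h2.congr fun n => ?_
      ring
    filter_upwards [hlim.eventually_le_const hρ1] with n hn
    have h1 : S (n + 1) = S n + g (n + 1) := by
      simp only [hS]
      rw [Finset.sum_range_succ _ (n + 1)]
      ring
    have h2 := hS1 n
    have h3 := hS1 (n + 1)
    rw [Real.norm_of_nonneg (by positivity), Real.norm_of_nonneg (by positivity), pow_succ]
    have h4 : S (n + 1) ≤ (1 + D / (n + 1)) * S n := by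
      have := hstep n
      rw [h1]
      linarith
    calc S (n + 1) * (q ^ n * q) ≤ (1 + D / (n + 1)) * S n * (q ^ n * q) := by gcongr
      _ = q * (1 + D / (n + 1)) * (S n * q ^ n) := by ring
      _ ≤ ρ * (S n * q ^ n) := by gcongr
  refine Summable.of_norm_bounded hsum fun n => ?_
  have h1 : ‖η n * (t ^ n / n.factorial)‖ = g n * q ^ n := by
    simp only [hg, hq]
    rw [Real.norm_eq_abs, abs_mul, abs_div, abs_pow, Nat.abs_cast, div_pow]
    field_simp
  rw [h1]
  have h2 : g n ≤ S n := by
    simp only [hS]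
    rw [Finset.sum_range_succ]
    have := Finset.sum_nonneg (s := Finset.range n) fun j _ => hg0 j
    linarith
  gcongr

theorem integral_sub_pow_mul_pow (i j : ℕ) (t : ℝ) :
    ∫ y in (0 : ℝ)..t, (t - y) ^ i / i.factorial * (y ^ j / j.factorial) =
      t ^ (i + j + 1) / (i + j + 1).factorial := by
  induction i generalizing j with
  | zero =>
    simp only [pow_zero, Nat.factorial_zero, Nat.cast_one, div_one, one_mul, zero_add]
    rw [intervalIntegral.integral_div, integral_pow, Nat.factorial_succ]
    simp
    field_simp
  | succ i ih =>
    have h1 : ∀ y : ℝ, HasDerivAt (fun y : ℝ => (t - y) ^ (i + 1) / (i + 1).factorial)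
        (-((t - y) ^ i / i.factorial)) y := by
      intro y
      refine ((((hasDerivAt_id y).const_sub t).pow (i + 1)).div_const _).congr_deriv ?_
      rw [Nat.factorial_succ]
      push_cast
      simp
      field_simp
    have h2 : ∀ y : ℝ, HasDerivAt (fun y : ℝ => y ^ (j + 1) / (j + 1).factorial)
        (y ^ j / j.factorial) y := by
      intro y
      refine (((hasDerivAt_id y).pow (j + 1)).div_const _).congr_deriv ?_
      rw [Nat.factorial_succ]
      push_cast
      simp
      field_simp
    rw [intervalIntegral.integral_mul_deriv_eq_deriv_mul (fun y _ => h1 y) (fun y _ => h2 y)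
      (Continuous.intervalIntegrable (by fun_prop) _ _)
      (Continuous.intervalIntegrable (by fun_prop) _ _)]
    simp only [neg_mul, intervalIntegral.integral_neg, ih (j + 1)]
    simp
    rw [show i + (j + 1) + 1 = i + 1 + j + 1 by ring]

open MeasureTheory in
/-- The convolution of two exponential generating functions. -/
theorem hasSum_convolution {β φ : ℕ → ℝ} {b f : ℝ → ℝ} {t : ℝ} (ht : 0 ≤ t)
    (hb : ∀ s ∈ Set.Icc 0 t, HasSum (fun n => β n * (s ^ n / n.factorial)) (b s))
    (hf : ∀ s ∈ Set.Icc 0 t, HasSum (fun n => φ n * (s ^ n / n.factorial)) (f s)) :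
    HasSum (fun n => (∑ p ∈ Finset.HasAntidiagonal.antidiagonal n, β p.1 * φ p.2) *
      (t ^ (n + 1) / (n + 1).factorial)) (∫ y in (0 : ℝ)..t, b (t - y) * f y) := by
  have htm : t ∈ Set.Icc 0 t := ⟨ht, le_rfl⟩
  have hB := (hb t htm).summable.norm
  have hF := (hf t htm).summable.norm
  have hBF := hB.mul_of_nonneg hF (fun _ => norm_nonneg _) fun _ => norm_nonneg _
  have hbound : ∀ (c s : ℝ) (n : ℕ), s ∈ Set.Icc 0 t →
      ‖c * (s ^ n / n.factorial)‖ ≤ ‖c * (t ^ n / n.factorial)‖ := by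
    intro c s n hs
    rw [norm_mul, norm_mul, Real.norm_of_nonneg (div_nonneg (pow_nonneg hs.1 n) (by positivity)),
      Real.norm_of_nonneg (div_nonneg (pow_nonneg ht n) (by positivity))]
    have := pow_le_pow_left₀ hs.1 hs.2 n
    gcongr
  have key : HasSum (fun p : ℕ × ℕ => ∫ y in (0 : ℝ)..t,
      β p.1 * ((t - y) ^ p.1 / p.1.factorial) * (φ p.2 * (y ^ p.2 / p.2.factorial)))
      (∫ y in (0 : ℝ)..t, b (t - y) * f y) := by
    have hterm : ∀ y ∈ Set.uIoc 0 t, ∀ p : ℕ × ℕ,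
        ‖β p.1 * ((t - y) ^ p.1 / p.1.factorial) * (φ p.2 * (y ^ p.2 / p.2.factorial))‖ ≤
          ‖β p.1 * (t ^ p.1 / p.1.factorial)‖ * ‖φ p.2 * (t ^ p.2 / p.2.factorial)‖ := by
      intro y hy p
      rw [Set.uIoc_of_le ht] at hy
      rw [norm_mul]
      exact mul_le_mul (hbound _ _ _ ⟨sub_nonneg.2 hy.2, by linarith [hy.1]⟩)
        (hbound _ _ _ ⟨hy.1.le, hy.2⟩) (norm_nonneg _) (norm_nonneg _)
    refine intervalIntegral.hasSum_integral_of_dominated_convergence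
      (fun p _ => ‖β p.1 * (t ^ p.1 / p.1.factorial)‖ * ‖φ p.2 * (t ^ p.2 / p.2.factorial)‖)
      (fun p => Continuous.aestronglyMeasurable (by fun_prop))
      (fun p => Filter.Eventually.of_forall fun y hy => hterm y hy p)
      (Filter.Eventually.of_forall fun y _ => hBF) (by simp)
      (Filter.Eventually.of_forall fun y hy => ?_)
    have hs := Summable.of_norm_bounded hBF (hterm y hy)
    rw [Set.uIoc_of_le ht] at hy
    exact (hb (t - y) ⟨sub_nonneg.2 hy.2, by linarith [hy.1]⟩).mul (hf y ⟨hy.1.le, hy.2⟩) hs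
  have e : ∀ p : ℕ × ℕ, (∫ y in (0 : ℝ)..t,
      β p.1 * ((t - y) ^ p.1 / p.1.factorial) * (φ p.2 * (y ^ p.2 / p.2.factorial))) =
      β p.1 * φ p.2 * (t ^ (p.1 + p.2 + 1) / (p.1 + p.2 + 1).factorial) := by
    intro p
    rw [← integral_sub_pow_mul_pow, ← intervalIntegral.integral_const_mul]
    congr 1
    funext y
    ring
  simp only [e] at key
  -- The double series is regrouped by `p.1 + p.2 = n`, on which the Beta integral depends only
  -- through `n`.
  rw [← Finset.HasAntidiagonal.sigmaAntidiagonalEquivProd.hasSum_iff] at key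
  refine key.sigma fun n => ?_
  rw [Finset.sum_mul, ← Finset.sum_coe_sort]
  have h := hasSum_fintype fun p : Finset.HasAntidiagonal.antidiagonal n =>
    β p.1.1 * φ p.1.2 * (t ^ (n + 1) / (n + 1).factorial)
  refine h.congr_fun fun p => ?_
  have hp := Finset.HasAntidiagonal.mem_antidiagonal.1 p.2
  simp only [Function.comp_apply, Finset.HasAntidiagonal.sigmaAntidiagonalEquivProd_apply]
  rw [hp]

/-! ### The formula as a power series and its Volterra equation. -/

theorem summable_renewalCoeff {lam mu : ℝ} (hlam : 0 < lam) (hmu : 0 < mu) (hne : mu ≠ lam)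
    (c : ℝ) {t : ℝ} (ht : |t| < Real.log (mu / lam) / (mu - lam)) :
    Summable fun n : ℕ => (-lam) ^ n * renewalCoeff c (mu / lam) n * (t ^ n / n.factorial) := by
  refine summable_of_renewal (R := Real.log (mu / lam) / (mu - lam)) (c := c)
    (fun s hs => (hasSum_deriv_halfLineProb hlam hmu hne hs).summable) (fun n => ?_) ht
  rw [renewalCoeff_succ, mul_add, Finset.mul_sum, Finset.mul_sum, Finset.mul_sum]
  congr 1
  refine Finset.sum_congr rfl fun p hp => ?_
  rw [← Finset.HasAntidiagonal.mem_antidiagonal.1 hp]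
  ring

theorem hasSum_exp_remainder (c z : ℝ) :
    HasSum (fun n : ℕ => if n < 2 then 0 else c ^ (n - 1) * (z ^ n / n.factorial))
      (1 / c * (Real.exp (z * c) - 1 - z * c)) := by
  rcases eq_or_ne c 0 with rfl | hc
  -- For `c = 0` the default `1 / 0 = 0` agrees with the limit, as `c ^ (n - 1) = 0` for `n ≥ 2`.
  · rw [div_zero, zero_mul]
    refine hasSum_zero.congr_fun fun n => ?_
    split_ifs with h
    · rfl
    · rw [zero_pow (by omega), zero_mul]
  · have h1 : HasSum (fun n : ℕ => (z * c) ^ n / n.factorial) (Real.exp (z * c)) := by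
      rw [Real.exp_eq_exp_ℝ]
      exact NormedSpace.expSeries_div_hasSum_exp (z * c)
    have h2 := ((h1.sub (hasSum_ite_eq 0 1)).sub (hasSum_ite_eq 1 (z * c))).mul_left (1 / c)
    refine h2.congr_fun fun n => ?_
    rcases n with _ | _ | n
    · simp
    · simp
    · simp
      field_simp
      ring

theorem originTerm_eq {d : ℕ} {lam mu t : ℝ} (n : ℕ) :
    originTerm d lam mu t n =
      (-lam) ^ n * renewalCoeff ((d : ℝ) - 1) (mu / lam) n * (t ^ n / n.factorial) -
        ((-lam) ^ n * (eulerianPoly n).eval (mu / lam) * (t ^ n / n.factorial) -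
          if n = 0 then 1 else 0) -
        if n < 2 then 0 else ((d : ℝ) - 1) ^ (n - 1) * ((-lam * t) ^ n / n.factorial) := by
  rcases n with _ | _ | n
  · simp [originTerm, renewalCoeff, eulerianPoly]
  · simp [originTerm, renewalCoeff, eulerianPoly_one, coeff_succ_eulerianSeries 0]
  · have h1 : ¬ (n + 1 + 1 < 2) := by omega
    rw [originTerm, renewalCoeff_add_two, if_neg h1, if_neg (by omega)]
    simp only [Nat.add_sub_cancel, mul_pow, ← neg_mul, show n + 1 + 1 - 2 = n by omega]
    ring

theorem hasSum_originTerm {d : ℕ} {lam mu : ℝ} (hlam : 0 < lam) (hmu : 0 < mu) (hne : mu ≠ lam)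
    {t : ℝ} (ht : |t| < Real.log (mu / lam) / (mu - lam)) :
    HasSum (fun n => originTerm d lam mu t (n + 3))
      ((∑' n : ℕ, (-lam) ^ n * renewalCoeff ((d : ℝ) - 1) (mu / lam) n * (t ^ n / n.factorial)) -
        (halfLineProb lam mu t - 1) -
        1 / ((d : ℝ) - 1) *
          (Real.exp (-lam * t * ((d : ℝ) - 1)) - 1 - -lam * t * ((d : ℝ) - 1))) := by
  have h1 := (((summable_renewalCoeff hlam hmu hne ((d : ℝ) - 1) ht).hasSum.sub
    ((hasSum_halfLineProb hlam hmu hne ht).sub (hasSum_ite_eq 0 1))).sub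
      (hasSum_exp_remainder ((d : ℝ) - 1) (-lam * t))).congr_fun
        fun n => originTerm_eq (d := d) (mu := mu) (t := t) n
  -- For `n ≤ 2` the range of `k` is empty, so the series may start at `0`.
  have h2 : ∑ n ∈ Finset.range 3, originTerm d lam mu t n = 0 := by
    simp [Finset.sum_range_succ, originTerm]
  rw [hasSum_nat_add_iff, h2, add_zero]
  exact h1

/-- The formula as a power series. -/
theorem originFormula_eq {d : ℕ} {lam mu : ℝ} (hlam : 0 < lam) (hmu : 0 < mu) (hne : mu ≠ lam)
    {t : ℝ} (ht : |t| < Real.log (mu / lam) / (mu - lam)) :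
    originFormula d lam mu t = 1 + d * ∑' n : ℕ,
      (-lam) ^ n * renewalCoeff ((d : ℝ) - 1) (mu / lam) n * (t ^ n / n.factorial) := by
  rw [originFormula, (hasSum_originTerm hlam hmu hne ht).tsum_eq, halfLineProb,
    show -(lam * t * ((d : ℝ) - 1)) = -lam * t * ((d : ℝ) - 1) by ring]
  ring

theorem hasSum_originFormula {d : ℕ} {lam mu : ℝ} (hlam : 0 < lam) (hmu : 0 < mu) (hne : mu ≠ lam)
    {t : ℝ} (ht : |t| < Real.log (mu / lam) / (mu - lam)) :
    HasSum (fun n : ℕ => ((if n = 0 then 1 else 0) +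
      d * ((-lam) ^ n * renewalCoeff ((d : ℝ) - 1) (mu / lam) n)) * (t ^ n / n.factorial))
      (originFormula d lam mu t) := by
  rw [originFormula_eq hlam hmu hne ht]
  refine ((hasSum_ite_eq 0 1).add
    ((summable_renewalCoeff hlam hmu hne ((d : ℝ) - 1) ht).hasSum.mul_left (d : ℝ))).congr_fun
      fun n => ?_
  split_ifs with h
  · subst h
    simp
  · ring

theorem continuousOn_originFormula {d : ℕ} {lam mu : ℝ} (hlam : 0 < lam) (hmu : 0 < mu)
    (hne : mu ≠ lam) {t : ℝ} (ht0 : 0 ≤ t) (ht : t < Real.log (mu / lam) / (mu - lam)) :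
    ContinuousOn (originFormula d lam mu) (Set.Icc 0 t) := by
  have hlt : ∀ s ∈ Set.Icc 0 t, |s| < Real.log (mu / lam) / (mu - lam) := fun s hs => by
    rw [abs_of_nonneg hs.1]
    exact hs.2.trans_lt ht
  have h1 : ContinuousOn (fun s => 1 + d * ∑' n : ℕ,
      (-lam) ^ n * renewalCoeff ((d : ℝ) - 1) (mu / lam) n * (s ^ n / n.factorial))
      (Set.Icc 0 t) := by
    refine continuousOn_const.add (continuousOn_const.mul (continuousOn_tsum
      (fun n => Continuous.continuousOn (by fun_prop))
      (summable_renewalCoeff hlam hmu hne ((d : ℝ) - 1) (hlt t ⟨ht0, le_rfl⟩)).norm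
      fun n s hs => ?_))
    have := pow_le_pow_left₀ hs.1 hs.2 n
    rw [norm_mul, norm_mul _ (t ^ n / _),
      Real.norm_of_nonneg (div_nonneg (pow_nonneg hs.1 n) (by positivity)),
      Real.norm_of_nonneg (div_nonneg (pow_nonneg ht0 n) (by positivity))]
    gcongr
  exact h1.congr fun s hs => originFormula_eq hlam hmu hne (hlt s hs)

theorem originFormula_volterra {d : ℕ} {lam mu : ℝ} (hlam : 0 < lam) (hmu : 0 < mu)
    (hne : mu ≠ lam) {t : ℝ} (ht0 : 0 ≤ t) (ht : t < Real.log (mu / lam) / (mu - lam)) :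
    SatisfiesVolterra d lam lam mu (originFormula d lam mu) t := by
  have hlt : ∀ s ∈ Set.Icc 0 t, |s| < Real.log (mu / lam) / (mu - lam) := fun s hs => by
    rw [abs_of_nonneg hs.1]
    exact hs.2.trans_lt ht
  have htt := hlt t ⟨ht0, le_rfl⟩
  refine ⟨ContinuousOn.intervalIntegrable_of_Icc ht0
    (((continuousOn_deriv_spiderG hlam hne).comp (f := fun y => t - y) (by fun_prop)
      fun y hy => sub_nonneg.2 hy.2).mul (continuousOn_originFormula hlam hmu hne ht0 ht)), ?_⟩
  have h1 := hasSum_convolution ht0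
    (fun s hs => hasSum_deriv_halfLineProb hlam hmu hne (hlt s hs))
    (fun s hs => hasSum_originFormula (d := d) hlam hmu hne (hlt s hs))
  -- Dropping the constant terms aligns both series with the degree shift of the convolution.
  have h2 := (hasSum_nat_add_iff' 1).2 (hasSum_halfLineProb hlam hmu hne htt)
  have h3 := (hasSum_nat_add_iff' 1).2 (hasSum_originFormula (d := d) hlam hmu hne htt)
  have h4 := h2.add (h1.mul_left ((d : ℝ) - 1))
  have h5 := h3.unique (h4.congr_fun fun n => ?_)
  · have hG : 1 - spiderG lam lam mu t = halfLineProb lam mu t := by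
      rw [spiderG_eq hlam hne, sub_sub_cancel]
    have hI : ∫ y in (0 : ℝ)..t, deriv (spiderG lam lam mu) (t - y) * originFormula d lam mu y =
        -∫ y in (0 : ℝ)..t, halfLineProb lam mu (t - y) *
          (mu - lam - mu * halfLineProb lam mu (t - y)) * originFormula d lam mu y := by
      rw [← intervalIntegral.integral_neg]
      refine intervalIntegral.integral_congr fun y hy => ?_
      rw [Set.uIcc_of_le ht0] at hy
      simp only [deriv_spiderG hlam hne (sub_nonneg.2 hy.2)]
      ring
    rw [hG, hI]
    simp [renewalCoeff, eulerianPoly] at h5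
    linarith
  · have e1 : ∑ p ∈ Finset.HasAntidiagonal.antidiagonal n,
        (-lam) ^ (p.1 + 1) * (eulerianPoly (p.1 + 1)).eval (mu / lam) *
          ((if p.2 = 0 then 1 else 0) +
            d * ((-lam) ^ p.2 * renewalCoeff ((d : ℝ) - 1) (mu / lam) p.2)) =
        (-lam) ^ (n + 1) * ((eulerianPoly (n + 1)).eval (mu / lam) +
          d * ∑ p ∈ Finset.HasAntidiagonal.antidiagonal n,
            (eulerianPoly (p.1 + 1)).eval (mu / lam) *
              renewalCoeff ((d : ℝ) - 1) (mu / lam) p.2) := by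
      have e2 : (-lam) ^ (n + 1) * (eulerianPoly (n + 1)).eval (mu / lam) =
          ∑ p ∈ Finset.HasAntidiagonal.antidiagonal n,
            (-lam) ^ (p.1 + 1) * (eulerianPoly (p.1 + 1)).eval (mu / lam) *
              (if p.2 = 0 then 1 else 0) := by
        rw [Finset.sum_eq_single_of_mem (n, 0) (by simp)]
        · simp
        · rintro ⟨i, j⟩ hp hne'
          rw [Finset.HasAntidiagonal.mem_antidiagonal] at hp
          have : j ≠ 0 := by
            rintro rfl
            exact hne' (by simpa using hp)
          simp [this]
      rw [mul_add, e2, Finset.mul_sum, Finset.mul_sum, ← Finset.sum_add_distrib]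
      refine Finset.sum_congr rfl fun p hp => ?_
      rw [mul_add, ← Finset.HasAntidiagonal.mem_antidiagonal.1 hp]
      ring
    -- The constant term `1` of the formula contributes `(d - 1) * A_{n+1}`; with `A_{n+1}` from `h`
    -- this makes `d * A_{n+1}`, as the recursion requires.
    rw [e1, if_neg (by omega), renewalCoeff_succ]
    ring

/-! ### Identification of the process with the formula. -/

theorem eq_of_satisfiesVolterra {d : ℕ} {lam mu : ℝ} (hlam : 0 < lam) (hne : mu ≠ lam)
    {f g : ℝ → ℝ} {t : ℝ} (ht : 0 ≤ t) (hf : ContinuousOn f (Set.Icc 0 t))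
    (hg : ContinuousOn g (Set.Icc 0 t))
    (hfv : ∀ s ∈ Set.Icc 0 t, SatisfiesVolterra d lam lam mu f s)
    (hgv : ∀ s ∈ Set.Icc 0 t, SatisfiesVolterra d lam lam mu g s) : f t = g t := by
  refine sub_eq_zero.1 (eq_zero_of_volterra (c := -((d : ℝ) - 1)) (e := fun s => f s - g s)
    ((continuousOn_deriv_spiderG hlam hne).mono Set.Icc_subset_Ici_self) (hf.sub hg)
    (fun s hs => ?_) t ⟨ht, le_rfl⟩)
  obtain ⟨hf1, hf2⟩ := hfv s hs
  obtain ⟨hg1, hg2⟩ := hgv s hs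
  simp only [mul_sub]
  rw [intervalIntegral.integral_sub hf1 hg1, hf2, hg2]
  ring

theorem mainTheorem5 (d : ℕ) (hd : 1 ≤ d) (α lam mu : ℝ) (hα : 0 < α) (hlam : 0 < lam)
    (hmu : 0 < mu) (hαlam : α = lam) (hne : mu ≠ lam) :
    (∀ t : ℝ, 0 < t → t < Real.log (mu / lam) / (mu - lam) →
      Summable (fun n : ℕ => originTerm d lam mu t (n + 3)) ∧
        SatisfiesVolterra d α lam mu (originFormula d lam mu) t) ∧
    (∀ (Ω : Type*) [MeasurableSpace Ω] (P : MeasureTheory.Measure Ω)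
        [MeasureTheory.IsProbabilityMeasure P] (N : ℝ≥0 → Ω → Spider d),
      IsSpiderProcess d α lam mu P N →
        ∀ t : ℝ, 0 < t → t < Real.log (mu / lam) / (mu - lam) →
          SatisfiesVolterra d α lam mu (originProb P N) t ∧
            originProb P N t = originFormula d lam mu t) := by
  rw [hαlam]
  refine ⟨fun t ht0 ht => ⟨?_, originFormula_volterra hlam hmu hne ht0.le ht⟩, ?_⟩
  · exact (hasSum_originTerm hlam hmu hne (by rwa [abs_of_pos ht0])).summable
  · intro Ω _ P _ N hN t ht0 ht
    obtain ⟨T, hT, hq, hM⟩ := hN.markov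
    rw [originProb_eq hN.initial hM]
    refine ⟨transition_volterra hd hlam hne hT hq ht0.le, ?_⟩
    exact eq_of_satisfiesVolterra hlam hne ht0.le
      (f := fun s => T s.toNNReal Spider.origin Spider.origin)
      ((hT.continuous hq _ _).comp continuous_real_toNNReal).continuousOn
      (continuousOn_originFormula hlam hmu hne ht0.le ht)
      (fun s hs => transition_volterra hd hlam hne hT hq hs.1)
      (fun s hs => originFormula_volterra hlam hmu hne hs.1 (hs.2.trans_lt ht))
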